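/- Let $\mathbb S^1=\mathbb R/\mathbb Z$ with its arc-length distance $d$ and uniform probability measure $\lambda$, and let $\mathrm W$ be the quadratic Wasserstein distance on Borel probability measures of $\mathbb S^1$, $\mathrm W(\mu,\nu)^2=\inf_\Pi\int d(x,y)^2\,\Pi(dx\,dy)$ over couplings $\Pi$ of $\mu$ and $\nu$. For a probability measure $\mu$ on $\mathbb S^1$ let $L^2_0(\mu)$ be the closure in $L^2(\mu)$ of the set of derivatives $f'$ of smooth functions $f:\mathbb S^1\to\mathbb R$, and for $v\in L^2(\mu)$ write $\mu+v:=(\mathrm{Id}+v)_\#\mu$. A map $f$ on probability measures has Gâteaux derivative $L$ at $\mu$ if $f(\mu)$ has no atom, $L:L^2_0(\mu)\to L^2_0(f(\mu))$ is linear and continuous, and for every $v\in L^2_0(\mu)$ \[\mathrm W\big(f(\mu+tv),\,f(\mu)+tLv\big)=o(t)\qquad(t\to0).\] Let $\Phi:\mathbb S^1\to\mathbb S^1$ be a $C^2$ map that is expanding, i.e. $|\Phi'(x)|>1$ for every $x$. Then $\Phi$ has a unique absolutely continuous invariant probability measure; it has the form $\rho\lambda$ with $\rho$ a positive $C^1$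 function, and every $v\in L^2(\rho\lambda)$ is $\lambda$-integrable and lies in $L^2_0(\rho\lambda)$ if and only if $\int v\,d\lambda=0$. The push-forward map $\Phi_\#$ has a Gâteaux derivative $\mathscr L:L^2_0(\rho\lambda)\to L^2_0(\rho\lambda)$ at $\rho\lambda$, given for almost every $x$ by \[\mathscr L v(x)=\sum_{y\in\Phi^{-1}(x)}\operatorname{sgn}(\Phi'(y))\,\frac{\rho(y)}{\rho(x)}\,v(y)\;-\;\frac{\displaystyle\int v\,\Phi'\,\frac{\rho}{\rho\circ\Phi}\,d\lambda}{\rho(x)\displaystyle\int \frac1\rho\,d\lambda}.\] (If $\Phi$ preserves orientation, the sign factor is $1$.) Moreover, the adjoint of $\mathscr L$ in the Hilbert space $L^2_0(\rho\lambda)$, with the inner product of $L^2(\rho\lambda)$, is \[\mathscr L^*u=\Phi'\;u\circ\Phi .\] -/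

import Mathlib

open MeasureTheory Filter Topology Asymptotics

noncomputable section

namespace CircleTransport

/-- The circle `ℝ / ℤ`, with the arc-length distance; `volume` is its uniform probability measure. -/
abbrev S1 : Type := UnitAddCircle

/-! ### Calculus on the circle -/

/-- A real function on the circle is of class `C^n` if it is so as a function of the angle. -/
def IsCn (n : WithTop ℕ∞) (f : S1 → ℝ) : Prop :=
  ContDiff ℝ n (fun x : ℝ => f (x : S1))

/-- The gradient (derivative) of a real function on the circle. -/
def grad (f : S1 → ℝ) (x : S1) : ℝ :=
  deriv (fun h : ℝ => f (x + (h : S1))) 0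

/-- The representative in `(-1/2, 1/2]` of a point of the circle: the standard chart at `0`. -/
def coord (z : S1) : ℝ :=
  (AddCircle.equivIoc (1 : ℝ) (-1 / 2) z : ℝ)

/-- The derivative `Φ'(x)` of a circle map, in the angular coordinate. -/
def circleDeriv (Φ : S1 → S1) (x : S1) : ℝ :=
  deriv (fun h : ℝ => coord (Φ (x + (h : S1)) - Φ x)) 0

/-- A circle map is of class `C^n` if it lifts to a map `ℝ → ℝ` of class `C^n`. -/
def IsCnMap (n : WithTop ℕ∞) (Φ : S1 → S1) : Prop :=
  ∃ F : ℝ → ℝ, ContDiff ℝ n F ∧ ∀ x : ℝ, Φ (x : S1) = (F x : S1)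

/-- `C²` expanding circle maps: `|Φ'| > 1`. -/
structure IsC2Expanding (Φ : S1 → S1) : Prop where
  isCnMap : IsCnMap 2 Φ
  one_lt_abs_circleDeriv : ∀ x, 1 < |circleDeriv Φ x|

theorem IsCnMap.continuous {n : WithTop ℕ∞} {Φ : S1 → S1} (h : IsCnMap n Φ) :
    Continuous Φ := by
  obtain ⟨F, hF, hl⟩ := h
  have h1 : Continuous (fun x : ℝ => ((F x : ℝ) : S1)) :=
    (AddCircle.continuous_mk' (1 : ℝ)).comp hF.continuous
  have h2 : Continuous (Φ ∘ (fun x : ℝ => (x : S1))) := h1.congr fun x => (hl x).symm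
  exact (QuotientAddGroup.isQuotientMap_mk (N := AddSubgroup.zmultiples (1 : ℝ))).continuous_iff.2 h2

theorem IsC2Expanding.measurable {Φ : S1 → S1} (h : IsC2Expanding Φ) : Measurable Φ :=
  h.isCnMap.continuous.measurable

/-! ### Probability measures on the circle -/

/-- The action `Φ_#` of a measurable circle map on probability measures. -/
def push (Φ : S1 → S1) (hΦ : Measurable Φ) (μ : ProbabilityMeasure S1) : ProbabilityMeasure S1 :=
  μ.map hΦ.aemeasurable

/-- Transport plans between `μ` and `ν`. -/
def transportPlans (μ ν : ProbabilityMeasure S1) : Set (Measure (S1 × S1)) :=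
  {π | π.map Prod.fst = (μ : Measure S1) ∧ π.map Prod.snd = (ν : Measure S1)}

/-- The quadratic Wasserstein distance on probability measures of the circle. -/
def W (μ ν : ProbabilityMeasure S1) : ℝ :=
  √(⨅ π ∈ transportPlans μ ν, ∫⁻ p, edist p.1 p.2 ^ 2 ∂π).toReal

/-! ### The first-order structure -/

/-- `L²_0(μ)`: the vector fields in `L²(μ)` that are `L²(μ)`-approximable by gradients of smooth
functions (these gradients already form a linear subspace). -/
def L20 (μ : ProbabilityMeasure S1) : Submodule ℝ (Lp ℝ 2 (μ : Measure S1)) :=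
  (Submodule.span ℝ {v : Lp ℝ 2 (μ : Measure S1) |
    ∃ f : S1 → ℝ, IsCn ((⊤ : ℕ∞) : WithTop ℕ∞) f ∧ v =ᵐ[(μ : Measure S1)] grad f}).topologicalClosure

instance L20.instCompleteSpace (μ : ProbabilityMeasure S1) : CompleteSpace (L20 μ) :=
  inferInstanceAs (CompleteSpace (Submodule.topologicalClosure _))

/-- The exponential map `μ + v := (Id + v)_# μ`. -/
def expMap (μ : ProbabilityMeasure S1) (v : Lp ℝ 2 (μ : Measure S1)) : ProbabilityMeasure S1 :=
  μ.map (f := fun x : S1 => x + ((v x : ℝ) : S1))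
    (measurable_id.aemeasurable.add
      ((AddCircle.continuous_mk' (1 : ℝ)).measurable.comp_aemeasurable
        (Lp.aestronglyMeasurable v).aemeasurable))

/-- `L : L²_0(μ) → L²_0(ν)` is a Gâteaux derivative at `μ` of the map `f` on probability measures,
where `ν = f μ` has no atom: for each `v`, `W (f (μ + t v), f μ + t L v) = o(t)` as `t → 0`. -/
def HasGateauxDerivAt (f : ProbabilityMeasure S1 → ProbabilityMeasure S1)
    {μ ν : ProbabilityMeasure S1} (L : L20 μ →L[ℝ] L20 ν) : Prop :=
  f μ = ν ∧ NullSingletonClass (ν : Measure S1) ∧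
    ∀ v : L20 μ,
      (fun t : ℝ => W (f (expMap μ (t • (v : Lp ℝ 2 (μ : Measure S1)))))
        (expMap ν (t • (L v : Lp ℝ 2 (ν : Measure S1))))) =o[𝓝 0] (fun t : ℝ => t)

end CircleTransport

end

open CircleTransport

noncomputable section

namespace CircleTransport

/-! ### Inverse functions and lifts -/

/-! Everything is computed on a lift `F` of `Φ` and its inverse `E` (`IsC2Expanding.nonempty_lift`),
whose translates `x ↦ E (x + j)`, `j < N`, are the inverse branches of `Φ`.

Invariant measure. The transfer operator `P` describes the action of `Φ_#` on densities. Inverse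
branches contract by `κ⁻¹` and the weight `w = |E'|` is log-Lipschitz, so `P` maps the densities
with `a`-Lipschitz logarithm into those with an `(a - 1)`-Lipschitz one. From these a fixed multiple
`c` of the uniform density can be split off without leaving the `a`-cone. Two orbits therefore share
mass `c` at each step and their distance decays like `(1 - c) ^ n` (`exists_contraction`). This
gives the fixed density, and the same estimate on derivatives makes it `C¹`
(`exists_invariant_density`). Uniqueness follows by approximating any invariant `L¹` density by a
continuous function and iterating.

Tangent space. In `L²(ρλ)` the inner product with `1/ρ` is the Lebesgue integral. A field is
orthogonal to all gradients exactly when it is a multiple of `1/ρ`, by Fourier series, so `L²_0` is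
the orthogonal complement of `1/ρ` (`HasDensity.mem_L20_iff`).

Derivative. The operator is defined as the adjoint of `u ↦ Φ' · u ∘ Φ` on `L²_0`, which makes its
continuity and its adjoint immediate. Duality between fibre sums and composition with `Φ` then
yields the formula; the multiple of `1/ρ` is the correction that restores mean zero
(`coeFn_derivL20`).

Differentiability. For a gradient `v`, the continuity equation suggests that `μ + tv` is close to
the measure `η` of density `ρ - t(ρv)'`. A map `X` built from distribution functions carries `η` to
`μ` with `p = X p + t v(X p) + O(t²)` (`exists_transport`). Since derivatives commute with signed
fibre sums, `Φ_# η` has density `ρ - t(ρ 𝓛v)'` (`map_dens_sub`), so a similar map `Y` serves for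
`𝓛v`. Drawing `p` from `η` couples the two measures to be compared, both endpoints being `O(t²)`
away from `Φ p` (`W_push_le`); no triangle inequality for `W` is needed. A general `v` is
approximated by gradients, at a cost proportional to `|t|` times the `L²` error (`isLittleO_W`). -/

theorem monotone_mul_sub_le {H : ℝ → ℝ} (hH : Differentiable ℝ H) {m : ℝ}
    (hm : ∀ x, m ≤ deriv H x) {x y : ℝ} (hxy : x ≤ y) : m * (y - x) ≤ H y - H x :=
  mul_sub_le_image_sub_of_le_deriv hH hm hxy

theorem abs_sub_le_of_abs_deriv_le {H : ℝ → ℝ} (hH : Differentiable ℝ H) {K : ℝ}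
    (hK : ∀ x, |deriv H x| ≤ K) (x y : ℝ) : |H x - H y| ≤ K * |x - y| := by
  have := Convex.norm_image_sub_le_of_norm_deriv_le (f := H) (s := Set.univ) (C := K)
    (fun x _ => hH x) (fun x _ => hK x) convex_univ (Set.mem_univ y) (Set.mem_univ x)
  simpa using this

theorem mul_abs_sub_le_of_le_deriv {H : ℝ → ℝ} (hH : Differentiable ℝ H) {m : ℝ}
    (hm : ∀ x, m ≤ deriv H x) (x y : ℝ) : m * |x - y| ≤ |H x - H y| := by
  rcases le_total x y with h | h
  · have := monotone_mul_sub_le hH hm h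
    rw [abs_sub_comm, abs_of_nonneg (sub_nonneg.2 h), abs_sub_comm]
    exact this.trans (le_abs_self _)
  · have := monotone_mul_sub_le hH hm h
    rw [abs_of_nonneg (sub_nonneg.2 h)]
    exact this.trans (le_abs_self _)

theorem exists_contDiff_inverse {n : WithTop ℕ∞} (hn : n ≠ 0) {H : ℝ → ℝ} (hH : ContDiff ℝ n H)
    {m : ℝ} (hm0 : 0 < m) (hm : ∀ x, m ≤ deriv H x) :
    ∃ Q : ℝ → ℝ, ContDiff ℝ n Q ∧ (∀ x, Q (H x) = x) ∧ ∀ x, H (Q x) = x := by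
  have hd : Differentiable ℝ H := hH.differentiable hn
  have hmono : StrictMono H := strictMono_of_deriv_pos fun x => hm0.trans_le (hm x)
  have hsurj : Function.Surjective H := by
    refine hH.continuous.surjective ?_ ?_
    · refine tendsto_atTop_mono' _ ?_ (tendsto_atTop_add_const_right _ (H 0)
        (tendsto_id.const_mul_atTop hm0))
      filter_upwards [eventually_ge_atTop 0] with x hx
      have := monotone_mul_sub_le hd hm hx
      simp only [id]; linarith
    · refine tendsto_atBot_mono' _ ?_ (tendsto_atBot_add_const_right _ (H 0)
        (tendsto_id.const_mul_atBot hm0))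
      filter_upwards [eventually_le_atBot 0] with x hx
      have := monotone_mul_sub_le hd hm hx
      simp only [id]; linarith
  let e : ℝ ≃ₜ ℝ := (StrictMono.orderIsoOfSurjective H hmono hsurj).toHomeomorph
  have he : (e : ℝ → ℝ) = H := rfl
  refine ⟨e.symm, e.contDiff_symm_deriv (f' := deriv H) (fun x => (hm0.trans_le (hm x)).ne')
    (fun x => (hd x).hasDerivAt) (he ▸ hH), fun x => ?_, fun x => ?_⟩
  · exact e.symm_apply_apply x
  · exact e.apply_symm_apply x

theorem coe_eq_coe_iff {x y : ℝ} : (x : S1) = (y : S1) ↔ ∃ n : ℤ, x = y + n := by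
  rw [← sub_eq_zero, ← AddCircle.coe_sub, AddCircle.coe_eq_zero_iff]
  constructor
  · rintro ⟨n, hn⟩
    refine ⟨n, ?_⟩
    simp at hn
    linarith
  · rintro ⟨n, hn⟩
    exact ⟨n, by simp; linarith⟩

theorem norm_coe_le_abs (x : ℝ) : ‖(x : S1)‖ ≤ |x| := by
  exact QuotientAddGroup.norm_mk_le_norm

/-- Small increments of the lift stay inside `(-1/2, 1/2)`, where `coord` recovers them exactly. -/
theorem circleDeriv_coe_of_lift {Φ : S1 → S1} {F : ℝ → ℝ} (hF : Differentiable ℝ F)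
    (h : ∀ x : ℝ, Φ (x : S1) = (F x : S1)) (x : ℝ) : circleDeriv Φ x = deriv F x := by
  have hev : (fun h : ℝ => coord (Φ (x + (h : S1)) - Φ x)) =ᶠ[𝓝 0] fun h => F (x + h) - F x := by
    have hc : Tendsto (fun h : ℝ => F (x + h) - F x) (𝓝 0) (𝓝 0) := by
      have : Continuous fun h : ℝ => F (x + h) - F x := by
        have := hF.continuous
        fun_prop
      simpa using this.tendsto 0
    filter_upwards [hc.eventually (Ioo_mem_nhds (show (-1 / 2 : ℝ) < 0 by norm_num)
      (show (0 : ℝ) < 1 / 2 by norm_num))] with t ht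
    rw [← AddCircle.coe_add, h, h, ← AddCircle.coe_sub, coord]
    refine AddCircle.equivIoc_coe_of_mem ⟨ht.1, ?_⟩
    linarith [ht.2]
  rw [circleDeriv, hev.deriv_eq, deriv_sub_const, deriv_comp_const_add]
  simp

/-- A lift `F` of a `C²` expanding circle map, of degree `s * N` with `s = ± 1`, together with its
inverse `E` and bounds on the derivative. -/
structure ExpandingLift (Φ : S1 → S1) where
  F : ℝ → ℝ
  E : ℝ → ℝ
  N : ℕ
  s : ℝ
  κ : ℝ
  K : ℝ
  s_eq : s = 1 ∨ s = -1
  contDiff_F : ContDiff ℝ 2 F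
  contDiff_E : ContDiff ℝ 2 E
  map_coe : ∀ x : ℝ, Φ x = F x
  F_E : ∀ x, F (E x) = x
  E_F : ∀ x, E (F x) = x
  F_add_one : ∀ x, F (x + 1) = F x + s * N
  one_lt : 1 < κ
  le_deriv : ∀ x, κ ≤ s * deriv F x
  deriv_le : ∀ x, s * deriv F x ≤ K
  N_pos : 0 < N

/-- The degree is a continuous integer-valued function on a connected space, hence constant. -/
theorem exists_int_of_lift {Φ : S1 → S1} {F : ℝ → ℝ} (hF : Continuous F)
    (h : ∀ x : ℝ, Φ (x : S1) = (F x : S1)) : ∃ d : ℤ, ∀ x, F (x + 1) = F x + d := by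
  have h1 : ∀ x, ∃ n : ℤ, F (x + 1) = F x + n := fun x => by
    rw [← coe_eq_coe_iff, ← h, ← h]
    simp
  choose n hn using h1
  have hc : Continuous n := by
    rw [Int.isClosedEmbedding_coe_real.isInducing.continuous_iff]
    have : (Int.cast ∘ n : ℝ → ℝ) = fun x => F (x + 1) - F x := by
      ext x
      simp [hn]
    rw [this]
    fun_prop
  exact ⟨n 0, fun x => by rw [hn, PreconnectedSpace.constant inferInstance hc (x := x) (y := 0)]⟩

theorem IsC2Expanding.nonempty_lift {Φ : S1 → S1} (hΦ : IsC2Expanding Φ) :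
    Nonempty (ExpandingLift Φ) := by
  obtain ⟨F, hF, hl⟩ := hΦ.isCnMap
  have hd : Differentiable ℝ F := hF.differentiable two_ne_zero
  have hc : Continuous (deriv F) := hF.continuous_deriv (by norm_num)
  have h1 : ∀ x, 1 < |deriv F x| := fun x => by
    rw [← circleDeriv_coe_of_lift hd hl]; exact hΦ.one_lt_abs_circleDeriv _
  obtain ⟨d, hdeg⟩ := exists_int_of_lift hF.continuous hl
  have hper : Function.Periodic (deriv F) 1 := fun x => by
    rw [← deriv_comp_add_const]
    simp [hdeg]
  -- By the intermediate value theorem, a nowhere vanishing continuous derivative has constant sign.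
  obtain ⟨s, hs, hpos⟩ : ∃ s : ℝ, (s = 1 ∨ s = -1) ∧ ∀ x, 0 < s * deriv F x := by
    have hne : ∀ x, deriv F x ≠ 0 := fun x h0 => by
      have := h1 x
      rw [h0] at this
      norm_num at this
    rcases lt_or_gt_of_ne (hne 0) with h0 | h0
    · refine ⟨-1, Or.inr rfl, fun x => ?_⟩
      by_contra hx
      obtain ⟨y, hy⟩ := mem_range_of_exists_le_of_exists_ge hc ⟨0, h0.le⟩
        (⟨x, by linarith⟩ : ∃ b, 0 ≤ deriv F b)
      exact hne y hy
    · refine ⟨1, Or.inl rfl, fun x => ?_⟩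
      by_contra hx
      obtain ⟨y, hy⟩ := mem_range_of_exists_le_of_exists_ge hc
        (⟨x, by linarith⟩ : ∃ b, deriv F b ≤ 0) ⟨0, h0.le⟩
      exact hne y hy
  have habs : ∀ x, |deriv F x| = s * deriv F x := fun x => by
    rw [← abs_of_pos (hpos x), abs_mul]
    rcases hs with rfl | rfl <;> simp
  -- Compactness makes the expansion uniform: `κ` and `K` are the extreme values of `s * F'` over a
  -- period.
  obtain ⟨x₀, -, hmin⟩ := isCompact_Icc.exists_isMinOn (Set.nonempty_Icc.2 (zero_le_one' ℝ))
    (f := fun x => s * deriv F x) (by fun_prop)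
  obtain ⟨x₁, -, hmax⟩ := isCompact_Icc.exists_isMaxOn (Set.nonempty_Icc.2 (zero_le_one' ℝ))
    (f := fun x => s * deriv F x) (by fun_prop)
  have hred : ∀ x, ∃ y ∈ Set.Icc (0 : ℝ) 1, deriv F x = deriv F y := fun x => by
    obtain ⟨y, hy, h⟩ := hper.exists_mem_Ico₀ one_pos x
    exact ⟨y, Set.Ico_subset_Icc_self hy, h⟩
  have hκ : ∀ x, s * deriv F x₀ ≤ s * deriv F x := fun x => by
    obtain ⟨y, hy, h⟩ := hred x
    rw [h]
    exact hmin hy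
  have hK : ∀ x, s * deriv F x ≤ s * deriv F x₁ := fun x => by
    obtain ⟨y, hy, h⟩ := hred x
    rw [h]
    exact hmax hy
  have hss : s * s = 1 := by rcases hs with rfl | rfl <;> norm_num
  have hder : ∀ x, deriv (fun x => s * F x) x = s * deriv F x := fun x => by
    rw [deriv_const_mul _ (hd x)]
  obtain ⟨Q, hQ, hQH, hHQ⟩ := exists_contDiff_inverse two_ne_zero
    (contDiff_const.mul hF : ContDiff ℝ 2 fun x => s * F x) (hpos x₀)
    (fun x => by rw [hder]; exact hκ x)
  have hdpos : 0 < s * d := by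
    have := monotone_mul_sub_le (H := fun x => s * F x) (by fun_prop)
      (fun x => by rw [hder]; exact hκ x) (zero_le_one' ℝ)
    have h3 := hdeg 0
    rw [zero_add] at h3
    rw [h3] at this
    have := hpos x₀
    nlinarith
  obtain ⟨N, hN⟩ : ∃ N : ℕ, (N : ℝ) = s * d := by
    rcases hs with rfl | rfl
    · refine ⟨d.toNat, ?_⟩
      have : 0 ≤ d := by
        have : (0 : ℝ) < d := by simpa using hdpos
        exact_mod_cast this.le
      rw [one_mul]
      exact_mod_cast Int.toNat_of_nonneg this
    · refine ⟨(-d).toNat, ?_⟩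
      have : 0 ≤ -d := by
        have : (0 : ℝ) < -d := by simpa using hdpos
        exact_mod_cast this.le
      rw [neg_one_mul]
      exact_mod_cast Int.toNat_of_nonneg this
  -- `Q` inverts the increasing function `s * F`; as `s * s = 1`, precomposing it with
  -- multiplication by `s` inverts `F` itself.
  refine ⟨⟨F, fun x => Q (s * x), N, s, s * deriv F x₀, s * deriv F x₁, hs, hF, by fun_prop, hl,
    fun x => ?_, hQH, fun x => ?_, ?_, hκ, hK, ?_⟩⟩
  · have := hHQ (s * x)
    calc F (Q (s * x)) = s * (s * F (Q (s * x))) := by rw [← mul_assoc, hss, one_mul]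
      _ = x := by rw [this, ← mul_assoc, hss, one_mul]
  · rw [hdeg, hN, ← mul_assoc, hss, one_mul]
  · rw [← habs]
    exact h1 x₀
  · rw [← hN] at hdpos
    exact_mod_cast hdpos

/-! ### Translation rules for the lift and its inverse, and bounds on the weight. -/

namespace ExpandingLift

variable {Φ : S1 → S1} (l : ExpandingLift Φ)

theorem s_mul_s : l.s * l.s = 1 := by rcases l.s_eq with h | h <;> rw [h] <;> norm_num

theorem abs_s : |l.s| = 1 := by rcases l.s_eq with h | h <;> rw [h] <;> norm_num

theorem differentiable_F : Differentiable ℝ l.F := l.contDiff_F.differentiable two_ne_zero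

theorem differentiable_E : Differentiable ℝ l.E := l.contDiff_E.differentiable two_ne_zero

theorem circleDeriv_coe (x : ℝ) : circleDeriv Φ x = deriv l.F x :=
  circleDeriv_coe_of_lift l.differentiable_F l.map_coe x

theorem deriv_pos (x : ℝ) : 0 < l.s * deriv l.F x :=
  (zero_lt_one.trans l.one_lt).trans_le (l.le_deriv x)

theorem abs_deriv (x : ℝ) : |deriv l.F x| = l.s * deriv l.F x := by
  rw [← abs_of_pos (l.deriv_pos x), abs_mul, l.abs_s, one_mul]

theorem abs_deriv_le (x : ℝ) : |deriv l.F x| ≤ l.K := by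
  rw [abs_deriv]; exact l.deriv_le x

theorem K_pos : 0 < l.K := (l.deriv_pos 0).trans_le (l.deriv_le 0)

theorem sign_deriv (x : ℝ) : Real.sign (deriv l.F x) = l.s := by
  have := l.deriv_pos x
  rcases l.s_eq with h | h <;> rw [h] at this ⊢
  · exact Real.sign_of_pos (by simpa using this)
  · exact Real.sign_of_neg (by simpa using this)

theorem F_add_int (x : ℝ) (n : ℤ) : l.F (x + n) = l.F x + n * (l.s * l.N) := by
  induction n with
  | zero => simp
  | succ i ih =>
    push_cast at ih ⊢
    rw [← add_assoc, l.F_add_one, ih]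
    ring
  | pred i ih =>
    push_cast at ih ⊢
    have := l.F_add_one (x + (-i - 1))
    rw [show x + (-(i : ℝ) - 1) + 1 = x + -i by ring, ih] at this
    linarith

theorem E_add_int (x : ℝ) (n : ℤ) : l.E (x + n * l.N) = l.E x + n * l.s := by
  have h := l.s_mul_s
  obtain ⟨m, hm⟩ : ∃ m : ℤ, (m : ℝ) = n * l.s := by
    rcases l.s_eq with h | h <;> rw [h]
    · exact ⟨n, by simp⟩
    · exact ⟨-n, by simp⟩
  rw [← hm, ← l.E_F (l.E x + m), F_add_int, F_E, hm]
  congr 2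
  linear_combination (-(n : ℝ) * l.N) * h

/-- The absolute value of the derivative of the inverse of the lift. -/
def w (x : ℝ) : ℝ := l.s * deriv l.E x

theorem deriv_F_mul_deriv_E (x : ℝ) : deriv l.F (l.E x) * deriv l.E x = 1 := by
  have h1 := ((l.differentiable_F (l.E x)).hasDerivAt).comp x (l.differentiable_E x).hasDerivAt
  have h2 : l.F ∘ l.E = id := funext l.F_E
  rw [h2] at h1
  exact h1.unique (hasDerivAt_id x)

theorem w_mul (x : ℝ) : l.w x * (l.s * deriv l.F (l.E x)) = 1 := by
  have := l.deriv_F_mul_deriv_E x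
  rw [w]
  linear_combination deriv l.F (l.E x) * deriv l.E x * l.s_mul_s + this

theorem w_eq (x : ℝ) : l.w x = (l.s * deriv l.F (l.E x))⁻¹ :=
  eq_inv_of_mul_eq_one_left (l.w_mul x)

theorem w_pos (x : ℝ) : 0 < l.w x := by rw [w_eq]; exact inv_pos.2 (l.deriv_pos _)

theorem w_le (x : ℝ) : l.w x ≤ l.κ⁻¹ := by
  rw [w_eq]
  exact inv_anti₀ (zero_lt_one.trans l.one_lt) (l.le_deriv _)

theorem le_w (x : ℝ) : l.K⁻¹ ≤ l.w x := by
  rw [w_eq]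
  exact inv_anti₀ (l.deriv_pos _) (l.deriv_le _)

theorem deriv_E_eq (x : ℝ) : deriv l.E x = l.s * l.w x := by
  rw [w, ← mul_assoc, s_mul_s, one_mul]

theorem abs_deriv_E (x : ℝ) : |deriv l.E x| = l.w x := by
  rw [deriv_E_eq, abs_mul, abs_s, one_mul, abs_of_pos (l.w_pos x)]

theorem contDiff_w : ContDiff ℝ 1 l.w :=
  contDiff_const.mul (l.contDiff_E.iterate_deriv' 1 1)

theorem E_add_N (x : ℝ) : l.E (x + l.N) = l.E x + l.s := by
  simpa using l.E_add_int x 1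

theorem w_add_N (x : ℝ) : l.w (x + l.N) = l.w x := by
  rw [w, w, ← deriv_comp_add_const]
  simp [l.E_add_N]

theorem comp_E_add_N {α : Type*} {h : ℝ → α} (hh : Function.Periodic h 1)
    (x : ℝ) : h (l.E (x + l.N)) = h (l.E x) := by
  rw [l.E_add_N]
  rcases l.s_eq with h | h <;> rw [h]
  · exact hh _
  · have := hh (l.E x + -1)
    rw [← this]
    simp

end ExpandingLift

/-! ### Periodic functions and the transfer operator. -/

theorem exists_abs_le_of_periodic {f : ℝ → ℝ} (hf : Continuous f) {c : ℝ} (hc : c ≠ 0)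
    (hp : Function.Periodic f c) : ∃ C, 0 < C ∧ ∀ x, |f x| ≤ C := by
  obtain ⟨C, hC⟩ := (hp.isBounded_of_continuous hc hf).exists_norm_le
  exact ⟨max C 1, by positivity, fun x => (hC (f x) (Set.mem_range_self x)).trans (le_max_left _ _)⟩

theorem intervalIntegral_sum_shift {ψ : ℝ → ℝ} (hψ : Continuous ψ) (N : ℕ) :
    ∫ x in (0 : ℝ)..1, ∑ j ∈ Finset.range N, ψ (x + j) = ∫ x in (0 : ℝ)..N, ψ x := by
  rw [intervalIntegral.integral_finsetSum (f := fun (j : ℕ) x => ψ (x + j)) fun j _ =>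
    (hψ.comp (continuous_add_const (j : ℝ))).intervalIntegrable _ _]
  have := intervalIntegral.sum_integral_adjacent_intervals (μ := volume) (f := ψ)
    (a := fun n : ℕ => (n : ℝ)) (n := N) (fun k _ => hψ.intervalIntegrable _ _)
  rw [Nat.cast_zero] at this
  rw [← this]
  refine Finset.sum_congr rfl fun j _ => ?_
  rw [intervalIntegral.integral_comp_add_right]
  push_cast
  rw [zero_add, add_comm]

/-- Peeling either the first or the last term off the sum over `range (N + 1)` gives the two sides;
the peeled terms agree by `h`. -/
theorem sum_range_shift {f : ℝ → ℝ} {N : ℕ} {x : ℝ} (h : f (x + N) = f x) :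
    ∑ j ∈ Finset.range N, f (x + 1 + j) = ∑ j ∈ Finset.range N, f (x + j) := by
  have h1 := Finset.sum_range_succ (fun j : ℕ => f (x + j)) N
  have h2 := Finset.sum_range_succ' (fun j : ℕ => f (x + j)) N
  rw [h1, h] at h2
  simp only [Nat.cast_zero, add_zero, add_left_inj] at h2
  rw [h2]
  refine Finset.sum_congr rfl fun j _ => ?_
  push_cast
  ring_nf

namespace ExpandingLift

variable {Φ : S1 → S1} (l : ExpandingLift Φ)

/-- The Ruelle transfer operator, acting on functions of the angle. -/
def P (h : ℝ → ℝ) (x : ℝ) : ℝ :=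
  ∑ j ∈ Finset.range l.N, h (l.E (x + j)) * l.w (x + j)

theorem continuous_E : Continuous l.E := l.contDiff_E.continuous

theorem continuous_w : Continuous l.w := l.contDiff_w.continuous

theorem continuous_P {h : ℝ → ℝ} (hh : Continuous h) : Continuous (l.P h) := by
  have := l.continuous_E
  have := l.continuous_w
  unfold P
  fun_prop

theorem periodic_P {h : ℝ → ℝ} (hh : Function.Periodic h 1) : Function.Periodic (l.P h) 1 :=
  fun x => sum_range_shift (f := fun y => h (l.E y) * l.w y)
    (by rw [l.comp_E_add_N hh, l.w_add_N])

/-- The `N` translates of the unit interval tile `[0, N]`, which `E` maps bijectively onto a single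
period; the substitution is paid for by `w`. -/
theorem integral_P {h : ℝ → ℝ} (hh : Continuous h) (hp : Function.Periodic h 1) :
    ∫ x in (0 : ℝ)..1, l.P h x = ∫ x in (0 : ℝ)..1, h x := by
  have := l.continuous_E
  have := l.continuous_w
  have h1 := intervalIntegral_sum_shift (ψ := fun y => h (l.E y) * l.w y) (by fun_prop) l.N
  have h2 := intervalIntegral.integral_comp_mul_deriv (a := (0 : ℝ)) (b := l.N) (f := l.E)
    (f' := deriv l.E) (g := h) (fun x _ => (l.differentiable_E x).hasDerivAt)
    (l.contDiff_E.continuous_deriv (by norm_num)).continuousOn hh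
  have h3 := l.E_add_N 0
  rw [zero_add] at h3
  have h4 : ∀ x, h (l.E x) * l.w x = l.s * ((h ∘ l.E) x * deriv l.E x) := fun x => by
    simp only [w, Function.comp]; ring
  unfold P
  rw [h1]
  simp_rw [h4]
  rw [intervalIntegral.integral_const_mul, h2, h3]
  rcases l.s_eq with h | h <;> rw [h]
  · rw [hp.intervalIntegral_add_eq (l.E 0) 0, one_mul, zero_add]
  -- When orientation is reversed, `E` maps `[0, N]` onto `[E 0 - 1, E 0]`, and `s = -1` restores
  -- the sign.
  · have := hp.intervalIntegral_add_eq (l.E 0 + -1) 0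
    rw [intervalIntegral.integral_symm, ← zero_add (1 : ℝ), ← this]
    simp

theorem P_add_mul (f g : ℝ → ℝ) (α β : ℝ) (x : ℝ) :
    l.P (fun y => α * f y + β * g y) x = α * l.P f x + β * l.P g x := by
  simp only [P, Finset.mul_sum, ← Finset.sum_add_distrib]
  exact Finset.sum_congr rfl fun j _ => by ring

theorem P_mono {f g : ℝ → ℝ} (h : ∀ x, f x ≤ g x) (x : ℝ) : l.P f x ≤ l.P g x :=
  Finset.sum_le_sum fun _ _ => mul_le_mul_of_nonneg_right (h _) (l.w_pos _).le

theorem abs_E_sub_le (x y : ℝ) : |l.E x - l.E y| ≤ l.κ⁻¹ * |x - y| :=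
  abs_sub_le_of_abs_deriv_le l.differentiable_E
    (fun x => by rw [abs_deriv_E]; exact l.w_le x) x y

/-- Bounded distortion: `w'` is bounded by some `B` and `w ≥ K⁻¹`, so `log w` is Lipschitz with
constant `B * K`. This is where the `C²` hypothesis matters. -/
theorem exists_w_le_exp : ∃ b, 0 < b ∧ ∀ x y, l.w x ≤ Real.exp (b * |x - y|) * l.w y := by
  have hc : Continuous (deriv l.w) := l.contDiff_w.continuous_deriv le_rfl
  have hp : Function.Periodic (deriv l.w) l.N := fun x => by
    rw [← deriv_comp_add_const]
    simp [l.w_add_N]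
  obtain ⟨B, hB0, hB⟩ := exists_abs_le_of_periodic hc (by exact_mod_cast l.N_pos.ne') hp
  have hK := l.K_pos
  refine ⟨B * l.K, by positivity, fun x y => ?_⟩
  have h1 := abs_sub_le_of_abs_deriv_le (l.contDiff_w.differentiable one_ne_zero) hB x y
  have h2 : 1 ≤ l.K * l.w y := by
    have := mul_le_mul_of_nonneg_left (l.le_w y) hK.le
    rwa [mul_inv_cancel₀ hK.ne'] at this
  have h3 := Real.add_one_le_exp (B * l.K * |x - y|)
  calc l.w x ≤ l.w y + B * |x - y| := by linarith [le_abs_self (l.w x - l.w y)]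
    _ ≤ l.w y + B * |x - y| * (l.K * l.w y) := by
        have : 0 ≤ B * |x - y| := by positivity
        nlinarith
    _ = (B * l.K * |x - y| + 1) * l.w y := by ring
    _ ≤ _ := mul_le_mul_of_nonneg_right h3 (l.w_pos y).le

end ExpandingLift

/-! ### Contraction on a cone of log-Lipschitz densities -/

/-- Probability densities on the circle whose logarithm is `a`-Lipschitz. -/
structure IsConeDensity (a : ℝ) (h : ℝ → ℝ) : Prop where
  continuous : Continuous h
  periodic : Function.Periodic h 1
  integral_eq : ∫ x in (0 : ℝ)..1, h x = 1
  nonneg : ∀ x, 0 ≤ h x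
  le_exp : ∀ x y, h x ≤ Real.exp (a * |x - y|) * h y

namespace IsConeDensity

variable {a : ℝ} {h : ℝ → ℝ}

theorem one (ha : 0 ≤ a) : IsConeDensity a (fun _ => 1) where
  continuous := continuous_const
  periodic := fun _ => rfl
  integral_eq := by simp
  nonneg := fun _ => zero_le_one
  le_exp := fun x y => by
    rw [mul_one]
    exact Real.one_le_exp (by positivity)

theorem mono (hh : IsConeDensity a h) {b : ℝ} (hab : a ≤ b) : IsConeDensity b h :=
  { hh with
    le_exp := fun x y => (hh.le_exp x y).trans (mul_le_mul_of_nonneg_right (Real.exp_le_exp.2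
      (mul_le_mul_of_nonneg_right hab (abs_nonneg _))) (hh.nonneg y)) }

/-- The mean over a period is `1` and every point of a unit interval starting at `x` is within
distance `1` of `x`; averaging the cone inequality gives the bound. -/
theorem le_const (hh : IsConeDensity a h) (ha : 0 ≤ a) (x : ℝ) : h x ≤ Real.exp a := by
  have h1 : ∀ y ∈ Set.Icc x (x + 1), h x ≤ Real.exp a * h y := fun y hy =>
    (hh.le_exp x y).trans (mul_le_mul_of_nonneg_right (Real.exp_le_exp.2 (by
      have : |x - y| ≤ 1 := by rw [abs_le]; constructor <;> linarith [hy.1, hy.2]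
      nlinarith)) (hh.nonneg y))
  have hc := hh.continuous
  have h2 := intervalIntegral.integral_mono_on (a := x) (b := x + 1) (μ := volume) (by linarith)
    (f := fun _ => h x) (g := fun y => Real.exp a * h y) (by simp)
    (Continuous.intervalIntegrable (by fun_prop) _ _) h1
  rw [intervalIntegral.integral_const_mul, hh.periodic.intervalIntegral_add_eq x 0, zero_add,
    hh.integral_eq] at h2
  simpa using h2

theorem const_le (hh : IsConeDensity a h) (ha : 0 ≤ a) (y : ℝ) : Real.exp (-a) ≤ h y := by
  have h1 : ∀ x ∈ Set.Icc y (y + 1), h x ≤ Real.exp a * h y := fun x hx =>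
    (hh.le_exp x y).trans (mul_le_mul_of_nonneg_right (Real.exp_le_exp.2 (by
      have : |x - y| ≤ 1 := by rw [abs_le]; constructor <;> linarith [hx.1, hx.2]
      nlinarith)) (hh.nonneg y))
  have h2 := intervalIntegral.integral_mono_on (a := y) (b := y + 1) (μ := volume) (by linarith)
    (f := h) (g := fun _ => Real.exp a * h y) (hh.continuous.intervalIntegrable _ _) (by simp) h1
  rw [hh.periodic.intervalIntegral_add_eq y 0, zero_add, hh.integral_eq] at h2
  rw [Real.exp_neg, inv_le_iff_one_le_mul₀' (Real.exp_pos a)]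
  simpa using h2

/-- Each branch contracts distances by `κ⁻¹`, which turns `a` into `a * κ⁻¹`, and the weight
contributes its distortion `b`. Sums of positive terms keep the inequality. -/
theorem transfer {Φ : S1 → S1} (l : ExpandingLift Φ) {b : ℝ}
    (hb : ∀ x y, l.w x ≤ Real.exp (b * |x - y|) * l.w y) (ha : 0 ≤ a)
    (hh : IsConeDensity a h) : IsConeDensity (a * l.κ⁻¹ + b) (l.P h) where
  continuous := l.continuous_P hh.continuous
  periodic := l.periodic_P hh.periodic
  integral_eq := by rw [l.integral_P hh.continuous hh.periodic, hh.integral_eq]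
  nonneg := fun x => Finset.sum_nonneg fun j _ => mul_nonneg (hh.nonneg _) (l.w_pos _).le
  le_exp := fun x y => by
    rw [ExpandingLift.P, ExpandingLift.P, Finset.mul_sum]
    refine Finset.sum_le_sum fun j _ => ?_
    have h1 := hh.le_exp (l.E (x + j)) (l.E (y + j))
    have h2 := hb (x + j) (y + j)
    have h3 := l.abs_E_sub_le (x + j) (y + j)
    rw [show x + j - (y + j) = x - y by ring] at h2 h3
    have h4 : h (l.E (x + j)) ≤ Real.exp (a * l.κ⁻¹ * |x - y|) * h (l.E (y + j)) :=
      h1.trans (mul_le_mul_of_nonneg_right (Real.exp_le_exp.2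
        (by rw [mul_assoc]; exact mul_le_mul_of_nonneg_left h3 ha)) (hh.nonneg _))
    refine (mul_le_mul h4 h2 (l.w_pos _).le
      (mul_nonneg (Real.exp_pos _).le (hh.nonneg _))).trans_eq ?_
    rw [add_mul, Real.exp_add]
    ring

/-- Bernoulli's inequality with base `exp (-r)` and real exponent `a`. -/
theorem one_sub_exp_le {a r : ℝ} (ha : 1 ≤ a) (hr : 0 ≤ r) :
    1 - Real.exp (-(a * r)) ≤ a * (1 - Real.exp (-r)) := by
  have h0 : Real.exp (-r) ≤ 1 := Real.exp_le_one_iff.2 (by linarith)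
  have := one_add_mul_self_le_rpow_one_add (s := Real.exp (-r) - 1)
    (by linarith [Real.exp_pos (-r)]) ha
  rw [show 1 + (Real.exp (-r) - 1) = Real.exp (-r) by ring, ← Real.exp_mul] at this
  rw [show -(a * r) = -r * a by ring]
  linarith

/-- Passing from `a - 1` to `a` leaves the slack `exp (a r) * (1 - exp (-r)) * h y` in the cone
inequality, where `r = |x - y|`. As `h ≥ exp (-a)`, `one_sub_exp_le` shows that this slack absorbs
the removal of the constant `exp (-a) / a`. -/
theorem exists_split (ha : 1 ≤ a) (hh : IsConeDensity (a - 1) h) :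
    ∃ k, IsConeDensity a k ∧
      ∀ x, h x = Real.exp (-a) / a + (1 - Real.exp (-a) / a) * k x := by
  have ha0 : 0 < a := zero_lt_one.trans_le ha
  set c := Real.exp (-a) / a with hc
  have hle : c ≤ Real.exp (-a) := div_le_self (Real.exp_pos _).le ha
  have hexp : Real.exp (-a) < 1 := Real.exp_lt_one_iff.2 (by linarith)
  have hc1 : 0 < 1 - c := by linarith
  have hlow : ∀ y, Real.exp (-a) ≤ h y := fun y =>
    (Real.exp_le_exp.2 (by linarith)).trans (hh.const_le (by linarith) y)
  have hcont := hh.continuous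
  refine ⟨fun x => (h x - c) / (1 - c), ⟨by fun_prop, fun x => ?_, ?_, fun x => ?_, fun x y => ?_⟩,
    fun x => ?_⟩
  · simp only [hh.periodic x]
  · rw [intervalIntegral.integral_div, intervalIntegral.integral_sub
      (hcont.intervalIntegrable _ _) (by simp), hh.integral_eq]
    simp [hc1.ne']
  · exact div_nonneg (by linarith [hlow x]) hc1.le
  · rw [← mul_div_assoc]
    refine div_le_div_of_nonneg_right ?_ hc1.le
    set r := |x - y| with hr
    have hr0 : 0 ≤ r := abs_nonneg _
    have h1 := hh.le_exp x y
    have h2 := one_sub_exp_le ha hr0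
    have h3 : Real.exp ((a - 1) * r) = Real.exp (a * r) * Real.exp (-r) := by
      rw [← Real.exp_add]; ring_nf
    have h4 : Real.exp (a * r) * Real.exp (-(a * r)) = 1 := by
      rw [← Real.exp_add]; simp
    have h5 : c * a = Real.exp (-a) := by rw [hc]; field_simp
    have h6 : 0 ≤ 1 - Real.exp (-r) := by
      linarith [Real.exp_le_one_iff.2 (show -r ≤ 0 by linarith)]
    have h7 := Real.exp_pos (a * r)
    have hc0 : 0 < c := div_pos (Real.exp_pos _) ha0
    rw [← hr, h3] at h1
    have h8 : c * (Real.exp (a * r) - 1) ≤ Real.exp (a * r) * (1 - Real.exp (-r)) * h y := by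
      calc c * (Real.exp (a * r) - 1)
          = c * Real.exp (a * r) * (1 - Real.exp (-(a * r))) := by linear_combination c * h4
        _ ≤ c * Real.exp (a * r) * (a * (1 - Real.exp (-r))) := by gcongr
        _ = Real.exp (a * r) * (1 - Real.exp (-r)) * Real.exp (-a) := by rw [← h5]; ring
        _ ≤ _ := by
          have := hlow y
          gcongr
    linarith
  · field_simp
    ring

end IsConeDensity

namespace ExpandingLift

variable {Φ : S1 → S1} (l : ExpandingLift Φ)

/-- Exponential contraction of the transfer operator on a cone of densities. -/
theorem exists_contraction : ∃ a q : ℝ, 1 ≤ a ∧ 0 < q ∧ q < 1 ∧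
    (∀ h, IsConeDensity a h → IsConeDensity a (l.P h)) ∧
    ∀ n h k, IsConeDensity a h → IsConeDensity a k →
      ∀ x, |l.P^[n] h x - l.P^[n] k x| ≤ Real.exp a * q ^ n := by
  obtain ⟨b, hb0, hb⟩ := l.exists_w_le_exp
  have hκ : l.κ⁻¹ < 1 := inv_lt_one_of_one_lt₀ l.one_lt
  have hκ0 : 0 < l.κ⁻¹ := inv_pos.2 (zero_lt_one.trans l.one_lt)
  -- The solution of `a * κ⁻¹ + b = a - 1`: one application of `P` gains exactly the unit that
  -- `exists_split` needs.
  set a := (b + 1) / (1 - l.κ⁻¹) with ha_def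
  have ha : a * (1 - l.κ⁻¹) = b + 1 := div_mul_cancel₀ _ (by linarith)
  have ha1 : 1 ≤ a := by
    rw [ha_def, le_div_iff₀ (by linarith)]
    linarith
  have ha0 : 0 < a := by linarith
  have hP : ∀ h, IsConeDensity a h → IsConeDensity (a - 1) (l.P h) := fun h hh =>
    (hh.transfer l hb ha0.le).mono (by linarith)
  set c := Real.exp (-a) / a with hc
  have hc0 : 0 < c := div_pos (Real.exp_pos _) ha0
  have hc1 : c < 1 := (div_le_self (Real.exp_pos _).le ha1).trans_lt (Real.exp_lt_one_iff.2 (by linarith))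
  refine ⟨a, 1 - c, ha1, by linarith, by linarith, fun h hh => (hP h hh).mono (by linarith), ?_⟩
  -- The same constant is split off from both densities, so it cancels in the difference and only a
  -- factor `1 - c` remains.
  have key : ∀ n h k, IsConeDensity a h → IsConeDensity a k →
      ∃ h' k', IsConeDensity a h' ∧ IsConeDensity a k' ∧
        ∀ x, l.P^[n] h x - l.P^[n] k x = (1 - c) ^ n * (h' x - k' x) := by
    intro n h k hh hk
    induction n with
    | zero => exact ⟨h, k, hh, hk, fun x => by simp⟩
    | succ n ih =>
      obtain ⟨h', k', hh', hk', he⟩ := ih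
      obtain ⟨h2, hh2, e2⟩ := (hP h' hh').exists_split ha1
      obtain ⟨k2, hk2, e3⟩ := (hP k' hk').exists_split ha1
      refine ⟨h2, k2, hh2, hk2, fun x => ?_⟩
      rw [Function.iterate_succ_apply', Function.iterate_succ_apply']
      have h4 := l.P_add_mul (l.P^[n] h) (l.P^[n] k) 1 (-1) x
      have h5 := l.P_add_mul h' k' ((1 - c) ^ n) (-(1 - c) ^ n) x
      have h6 : (fun y => 1 * l.P^[n] h y + -1 * l.P^[n] k y) =
          fun y => (1 - c) ^ n * h' y + -(1 - c) ^ n * k' y := by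
        ext y
        linear_combination he y
      rw [h6, h5, e2, e3] at h4
      rw [pow_succ]
      linear_combination -h4
  intro n h k hh hk x
  obtain ⟨h', k', hh', hk', he⟩ := key n h k hh hk
  rw [he, abs_mul, abs_of_nonneg (pow_nonneg (by linarith) n), mul_comm]
  refine mul_le_mul_of_nonneg_right ?_ (pow_nonneg (by linarith) n)
  rw [abs_le]
  constructor <;> linarith [hh'.le_const ha0.le x, hk'.le_const ha0.le x, hh'.nonneg x, hk'.nonneg x]

end ExpandingLift

/-! ### Uniform limits, Lipschitz approximation and the invariant density. -/

theorem exists_tendstoUniformly_of_le_geometric {u : ℕ → ℝ → ℝ} {C p : ℝ} (hp0 : 0 ≤ p) (hp : p < 1)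
    (h : ∀ n x, |u (n + 1) x - u n x| ≤ C * p ^ n) : ∃ U, TendstoUniformly u U atTop := by
  have h' : ∀ x n, dist (u n x) (u (n + 1) x) ≤ C * p ^ n := fun x n => by
    rw [dist_comm, Real.dist_eq]
    exact h n x
  choose U hU using fun x =>
    cauchySeq_tendsto_of_complete (cauchySeq_of_le_geometric p C hp (h' x))
  refine ⟨U, Metric.tendstoUniformly_iff.2 fun ε hε => ?_⟩
  have h1 : Tendsto (fun n : ℕ => C * p ^ n / (1 - p)) atTop (𝓝 0) := by
    have := ((tendsto_pow_atTop_nhds_zero_of_lt_one hp0 hp).const_mul C).div_const (1 - p)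
    simpa using this
  filter_upwards [h1.eventually (gt_mem_nhds hε)] with n hn x
  rw [dist_comm]
  exact (dist_le_of_le_geometric_of_tendsto p C hp (h' x) (hU x) n).trans_lt hn

theorem uniformContinuous_of_periodic {f : ℝ → ℝ} (hf : Continuous f)
    (hp : Function.Periodic f 1) : UniformContinuous f := by
  have h1 : Continuous (hp.lift : S1 → ℝ) := continuous_quot_lift _ hf
  have h2 := CompactSpace.uniformContinuous_of_continuous h1
  refine Metric.uniformContinuous_iff.2 fun ε hε => ?_
  obtain ⟨δ, hδ, h⟩ := Metric.uniformContinuous_iff.1 h2 ε hε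
  refine ⟨δ, hδ, fun x y hxy => h (a := (x : S1)) (b := (y : S1)) ?_⟩
  rw [dist_eq_norm, ← AddCircle.coe_sub]
  exact (norm_coe_le_abs _).trans_lt hxy

/-- Continuous periodic functions are uniform limits of Lipschitz ones. -/
theorem exists_lipschitz_periodic_approx {f : ℝ → ℝ} (hf : Continuous f)
    (hp : Function.Periodic f 1) {η : ℝ} (hη : 0 < η) :
    ∃ g : ℝ → ℝ, Continuous g ∧ Function.Periodic g 1 ∧
      (∃ L, 0 ≤ L ∧ ∀ x y, |g x - g y| ≤ L * |x - y|) ∧ ∀ x, |f x - g x| ≤ η := by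
  have huc : UniformContinuous f := uniformContinuous_of_periodic hf hp
  obtain ⟨δ, hδ, hδf⟩ := Metric.uniformContinuous_iff.1 huc η hη
  obtain ⟨C, hC0, hC⟩ := exists_abs_le_of_periodic hf one_ne_zero hp
  -- The approximant is the average of `f` over the window `[x, x + ε]`. Its derivative is the
  -- bounded difference quotient `ε⁻¹ * (f (x + ε) - f x)`.
  set ε := δ / 2 with hε_def
  have hε : 0 < ε := by positivity
  have hG : ∀ x, HasDerivAt (fun x => ∫ u in (0 : ℝ)..x, f u) (f x) x := fun x =>
    (hf.integral_hasStrictDerivAt 0 x).hasDerivAt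
  have hg : ∀ x, HasDerivAt
      (fun x => ε⁻¹ * ((∫ u in (0 : ℝ)..(x + ε), f u) - ∫ u in (0 : ℝ)..x, f u))
      (ε⁻¹ * (f (x + ε) - f x)) x := fun x =>
    (((hG (x + ε)).comp_add_const x ε).sub (hG x)).const_mul _
  have hint : ∀ x, (∫ u in (0 : ℝ)..(x + ε), f u) - ∫ u in (0 : ℝ)..x, f u =
      ∫ u in (0 : ℝ)..ε, f (x + u) := fun x => by
    rw [intervalIntegral.integral_interval_sub_left (hf.intervalIntegrable _ _)
      (hf.intervalIntegrable _ _), intervalIntegral.integral_comp_add_left, add_zero]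
  refine ⟨_, continuous_iff_continuousAt.2 fun x => (hg x).continuousAt, fun x => ?_,
    ⟨ε⁻¹ * (2 * C), by positivity, ?_⟩, fun x => ?_⟩
  · simp only [hint]
    congr 2
    ext u
    rw [← hp (x + u)]
    ring_nf
  · refine abs_sub_le_of_abs_deriv_le (fun x => (hg x).differentiableAt) fun x => ?_
    rw [(hg x).deriv, abs_mul, abs_of_pos (inv_pos.2 hε)]
    refine mul_le_mul_of_nonneg_left ?_ (by positivity)
    have h1 := hC (x + ε)
    have h2 := hC x
    rw [abs_le] at *
    constructor <;> linarith
  · have h1 : f x - ε⁻¹ * ((∫ u in (0 : ℝ)..(x + ε), f u) - ∫ u in (0 : ℝ)..x, f u) =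
        ε⁻¹ * ∫ u in (0 : ℝ)..ε, (f x - f (x + u)) := by
      rw [hint, intervalIntegral.integral_sub (by simp)
        (Continuous.intervalIntegrable (by fun_prop) _ _)]
      simp only [intervalIntegral.integral_const, smul_eq_mul]
      field_simp
      ring
    have h2 : ‖∫ u in (0 : ℝ)..ε, (f x - f (x + u))‖ ≤ η * |ε - 0| := by
      refine intervalIntegral.norm_integral_le_of_norm_le_const fun u hu => ?_
      rw [Set.uIoc_of_le hε.le] at hu
      refine (hδf (a := x) (b := x + u) ?_).le
      rw [Real.dist_eq, abs_sub_comm, add_sub_cancel_left, abs_of_pos hu.1]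
      linarith [hu.2]
    rw [h1, abs_mul, abs_of_pos (inv_pos.2 hε)]
    rw [sub_zero, abs_of_pos hε, Real.norm_eq_abs] at h2
    calc ε⁻¹ * _ ≤ ε⁻¹ * (η * ε) := by gcongr
      _ = η := by field_simp

namespace ExpandingLift

variable {Φ : S1 → S1} (l : ExpandingLift Φ)

theorem hasDerivAt_P {f f' : ℝ → ℝ} (hf : ∀ x, HasDerivAt f (f' x) x) (x : ℝ) :
    HasDerivAt (l.P f) (∑ j ∈ Finset.range l.N, (f' (l.E (x + j)) * (l.s * l.w (x + j)) *
      l.w (x + j) + f (l.E (x + j)) * deriv l.w (x + j))) x := by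
  refine HasDerivAt.fun_sum fun j _ => ?_
  have h1 : HasDerivAt (fun x => l.E (x + j)) (l.s * l.w (x + j)) x := by
    have := (l.differentiable_E (x + j)).hasDerivAt.comp_add_const x j
    rwa [deriv_E_eq] at this
  exact ((hf _).comp x h1).mul
    (((l.contDiff_w.differentiable one_ne_zero) (x + j)).hasDerivAt.comp_add_const x j)

theorem contDiff_P {f : ℝ → ℝ} (hf : ContDiff ℝ 1 f) : ContDiff ℝ 1 (l.P f) := by
  have h1 : ContDiff ℝ 1 l.E := l.contDiff_E.of_le one_le_two
  have h2 := l.contDiff_w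
  refine ContDiff.sum fun j _ => ?_
  fun_prop

theorem iterate_P_add_mul (f g : ℝ → ℝ) (α β : ℝ) (n : ℕ) (x : ℝ) :
    l.P^[n] (fun y => α * f y + β * g y) x = α * l.P^[n] f x + β * l.P^[n] g x := by
  induction n generalizing x with
  | zero => rfl
  | succ n ih =>
    simp only [Function.iterate_succ_apply']
    rw [← P_add_mul, funext ih]

theorem iterate_P_mono {f g : ℝ → ℝ} (h : ∀ x, f x ≤ g x) (n : ℕ) (x : ℝ) :
    l.P^[n] f x ≤ l.P^[n] g x := by
  induction n generalizing x with
  | zero => exact h x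
  | succ n ih =>
    simp only [Function.iterate_succ_apply']
    exact l.P_mono ih x

/-- The invariant density of an expanding map: existence, regularity, and decay of
correlations. -/
theorem exists_invariant_density : ∃ ρ : ℝ → ℝ, ContDiff ℝ 1 ρ ∧ Function.Periodic ρ 1 ∧
    (∀ x, 0 < ρ x) ∧ ∫ x in (0 : ℝ)..1, ρ x = 1 ∧ l.P ρ = ρ ∧
    ∀ f, Continuous f → Function.Periodic f 1 → ∀ ε > 0, ∃ n, ∀ x,
      |l.P^[n] f x - (∫ x in (0 : ℝ)..1, f x) * ρ x| ≤ ε := by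
  obtain ⟨a, q, ha1, hq0, hq1, hcone, hcontr⟩ := l.exists_contraction
  have ha0 : 0 ≤ a := zero_le_one.trans ha1
  set r : ℕ → ℝ → ℝ := fun n => l.P^[n] (fun _ => 1) with hr
  have hr_succ : ∀ n, r (n + 1) = l.P (r n) := fun n => Function.iterate_succ_apply' _ _ _
  have hr_cone : ∀ n, IsConeDensity a (r n) := fun n => by
    induction n with
    | zero => exact IsConeDensity.one ha0
    | succ n ih => rw [hr_succ]; exact hcone _ ih
  have hr_diff : ∀ n x, |r (n + 1) x - r n x| ≤ Real.exp a * q ^ n := fun n x =>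
    hcontr n (l.P fun _ => 1) (fun _ => 1) (hcone _ (IsConeDensity.one ha0))
      (IsConeDensity.one ha0) x
  obtain ⟨ρ, hρ⟩ := exists_tendstoUniformly_of_le_geometric hq0.le hq1 hr_diff
  have hρp : ∀ x, Tendsto (fun n => r n x) atTop (𝓝 (ρ x)) := fun x => hρ.tendsto_at x
  have hρc : Continuous ρ := hρ.continuous (Frequently.of_forall fun n => (hr_cone n).continuous)
  have hρ_per : Function.Periodic ρ 1 := fun x => tendsto_nhds_unique (hρp (x + 1))
    ((hρp x).congr fun n => ((hr_cone n).periodic x).symm)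
  have hρ_low : ∀ x, Real.exp (-a) ≤ ρ x := fun x =>
    ge_of_tendsto' (hρp x) fun n => (hr_cone n).const_le ha0 x
  have hρ_up : ∀ x, ρ x ≤ Real.exp a := fun x =>
    le_of_tendsto' (hρp x) fun n => (hr_cone n).le_const ha0 x
  have hρ_exp : ∀ x y, ρ x ≤ Real.exp (a * |x - y|) * ρ y := fun x y =>
    le_of_tendsto_of_tendsto' (hρp x) ((hρp y).const_mul _) fun n => (hr_cone n).le_exp x y
  have hρ_pos : ∀ x, 0 < ρ x := fun x => (Real.exp_pos _).trans_le (hρ_low x)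
  have hρ_inv : l.P ρ = ρ := funext fun x => by
    have h1 : Tendsto (fun n => l.P (r n) x) atTop (𝓝 (l.P ρ x)) :=
      tendsto_finsetSum _ fun j _ => (hρp _).mul_const _
    refine tendsto_nhds_unique h1 (((hρp x).comp (tendsto_add_atTop_nat 1)).congr fun n => ?_)
    rw [Function.comp, hr_succ]
  have hρ_int : ∫ x in (0 : ℝ)..1, ρ x = 1 := by
    refine tendsto_nhds_unique (f := fun n => ∫ x in (0 : ℝ)..1, r n x) (l := atTop) ?_ ?_
    · refine intervalIntegral.tendsto_integral_filter_of_dominated_convergence (fun _ => Real.exp a)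
        (Eventually.of_forall fun n => (hr_cone n).continuous.aestronglyMeasurable)
        (Eventually.of_forall fun n => Eventually.of_forall fun x _ => ?_) (by simp)
        (Eventually.of_forall fun x _ => hρp x)
      rw [Real.norm_of_nonneg ((hr_cone n).nonneg x)]
      exact (hr_cone n).le_const ha0 x
    · simp only [(hr_cone _).integral_eq]
      exact tendsto_const_nhds
  have hρ_cone : IsConeDensity a ρ := ⟨hρc, hρ_per, hρ_int, fun x => (hρ_pos x).le, hρ_exp⟩
  have hr_C1 : ∀ n, ContDiff ℝ 1 (r n) := fun n => by
    induction n with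
    | zero => exact contDiff_const
    | succ n ih => rw [hr_succ]; exact l.contDiff_P ih
  have hr_der : ∀ n x, HasDerivAt (r n) (deriv (r n) x) x := fun n x =>
    ((hr_C1 n).differentiable one_ne_zero x).hasDerivAt
  refine ⟨ρ, ?_, hρ_per, hρ_pos, hρ_int, hρ_inv, ?_⟩
  · obtain ⟨B, hB0, hB⟩ := exists_abs_le_of_periodic (l.contDiff_w.continuous_deriv le_rfl)
      (c := (l.N : ℝ)) (by exact_mod_cast l.N_pos.ne') (fun x => by
        rw [← deriv_comp_add_const]
        simp [l.w_add_N])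
    obtain ⟨D, hD0, hD⟩ := exists_abs_le_of_periodic (f := deriv (r 1))
      ((hr_C1 1).continuous_deriv le_rfl) one_ne_zero (fun x => by
        rw [← deriv_comp_add_const]
        simp only [(hr_cone 1).periodic _])
    have hκ : l.κ⁻¹ < 1 := inv_lt_one_of_one_lt₀ l.one_lt
    have hκ0 : 0 < l.κ⁻¹ := inv_pos.2 (zero_lt_one.trans l.one_lt)
    -- The derivatives converge at a rate `p` slower than both the branch contraction `κ⁻¹` and the
    -- decay `q` of the densities themselves.
    obtain ⟨p, hp, hp1⟩ := exists_between (max_lt hκ hq1)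
    have hpκ : l.κ⁻¹ < p := (le_max_left _ _).trans_lt hp
    have hpq : q < p := (le_max_right _ _).trans_lt hp
    have hp0 : 0 < p := hq0.trans hpq
    obtain ⟨A, hA⟩ : ∃ A, A = l.N * B * Real.exp a * Real.exp a := ⟨_, rfl⟩
    have hA0 : 0 ≤ A := by rw [hA]; positivity
    -- The first term covers the base case; the second ensures `κ⁻¹ * M + A ≤ M * p`, which closes
    -- the induction.
    obtain ⟨M, hM⟩ : ∃ M, M = D * Real.exp a + A / (p - l.κ⁻¹) := ⟨_, rfl⟩
    have hpκ' : 0 < p - l.κ⁻¹ := sub_pos.2 hpκ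
    have hMA : A ≤ M * (p - l.κ⁻¹) := by
      rw [hM, add_mul, div_mul_cancel₀ _ hpκ'.ne']
      have : 0 ≤ D * Real.exp a * (p - l.κ⁻¹) := by positivity
      linarith
    have hMD : D * Real.exp a ≤ M := by
      rw [hM]
      have : 0 ≤ A / (p - l.κ⁻¹) := by positivity
      linarith
    have hM0 : 0 ≤ M := le_trans (by positivity) hMD
    have hea : Real.exp a * Real.exp (-a) = 1 := by rw [← Real.exp_add]; simp
    have h1ρ : ∀ x, 1 ≤ Real.exp a * ρ x := fun x => by
      rw [← hea]
      exact mul_le_mul_of_nonneg_left (hρ_low x) (Real.exp_pos a).le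
    -- The bound carries the weight `ρ` because the sum over branches is then controlled by `P ρ =
    -- ρ`. Differentiating through `E` produces a second factor `w`, bounded by `κ⁻¹`, while terms
    -- with `w'` only involve differences of the densities.
    have hδ : ∀ n x, |deriv (r (n + 1)) x - deriv (r n) x| ≤ M * p ^ n * ρ x := by
      intro n
      induction n with
      | zero =>
        intro x
        have h0 : deriv (r 0) x = 0 := deriv_const x 1
        rw [h0, sub_zero, pow_zero, mul_one]
        calc |deriv (r 1) x| ≤ D * 1 := by rw [mul_one]; exact hD x
          _ ≤ D * (Real.exp a * ρ x) := mul_le_mul_of_nonneg_left (h1ρ x) hD0.le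
          _ = D * Real.exp a * ρ x := by ring
          _ ≤ _ := mul_le_mul_of_nonneg_right hMD (hρ_pos x).le
      | succ n ih =>
        intro x
        have e := fun m => (l.hasDerivAt_P (hr_der m) x).deriv
        simp only [← hr_succ] at e
        rw [e, e, ← Finset.sum_sub_distrib]
        calc _ ≤ ∑ j ∈ Finset.range l.N,
              (l.κ⁻¹ * (M * p ^ n) * (ρ (l.E (x + j)) * l.w (x + j)) +
                B * (Real.exp a * p ^ n)) := by
              refine (Finset.abs_sum_le_sum_abs _ _).trans (Finset.sum_le_sum fun j _ => ?_)
              set y := l.E (x + j)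
              set v := l.w (x + j)
              have hv : 0 < v := l.w_pos _
              have hv' : v ≤ l.κ⁻¹ := l.w_le _
              have t1 : deriv (r (n + 1)) y * (l.s * v) * v + r (n + 1) y * deriv l.w (x + j) -
                  (deriv (r n) y * (l.s * v) * v + r n y * deriv l.w (x + j)) =
                  (deriv (r (n + 1)) y - deriv (r n) y) * (l.s * v) * v +
                  (r (n + 1) y - r n y) * deriv l.w (x + j) := by ring
              rw [t1]
              refine (abs_add_le _ _).trans (add_le_add ?_ ?_)
              · rw [abs_mul, abs_mul, abs_mul, l.abs_s, one_mul, abs_of_pos hv]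
                calc _ ≤ M * p ^ n * ρ y * l.κ⁻¹ * v := by
                      have := ih y
                      gcongr
                      have := hρ_pos y
                      positivity
                  _ = _ := by ring
              · rw [abs_mul, mul_comm]
                have h1 := hr_diff n y
                have h2 : q ^ n ≤ p ^ n := pow_le_pow_left₀ hq0.le hpq.le n
                exact mul_le_mul (hB _) (h1.trans (by gcongr)) (abs_nonneg _) hB0.le
          _ = l.κ⁻¹ * (M * p ^ n) * l.P ρ x + l.N * B * Real.exp a * p ^ n := by
              rw [Finset.sum_add_distrib, ← Finset.mul_sum, P]
              simp
              ring
          _ ≤ l.κ⁻¹ * (M * p ^ n) * ρ x + l.N * B * Real.exp a * p ^ n * (Real.exp a * ρ x) := by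
              rw [hρ_inv]
              have : 0 ≤ l.N * B * Real.exp a * p ^ n := by positivity
              nlinarith [h1ρ x]
          _ = (l.κ⁻¹ * M + A) * (p ^ n * ρ x) := by rw [hA]; ring
          _ ≤ (M * p) * (p ^ n * ρ x) := by
              have := hρ_pos x
              refine mul_le_mul_of_nonneg_right ?_ (by positivity)
              linarith
          _ = _ := by ring
    obtain ⟨h, hh⟩ := exists_tendstoUniformly_of_le_geometric (u := fun n => deriv (r n))
      (C := M * Real.exp a) hp0.le hp1 (fun n x => (hδ n x).trans (by
        calc _ ≤ M * p ^ n * Real.exp a :=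
              mul_le_mul_of_nonneg_left (hρ_up x) (by positivity)
          _ = _ := by ring))
    have hd : ∀ x, HasDerivAt ρ (h x) x := fun x =>
      hasDerivAt_of_tendstoUniformly hh (Eventually.of_forall hr_der) hρp x
    have hhc : Continuous h := hh.continuous
      (Frequently.of_forall fun n => (hr_C1 n).continuous_deriv le_rfl)
    refine contDiff_one_iff_deriv.2 ⟨fun x => (hd x).differentiableAt, ?_⟩
    rwa [funext fun x => (hd x).deriv]
  · have hiter_ρ : ∀ n, l.P^[n] ρ = ρ := fun n => Function.iterate_fixed hρ_inv n
    have hlip : ∀ g, Continuous g → Function.Periodic g 1 →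
        (∃ L, 0 ≤ L ∧ ∀ x y, |g x - g y| ≤ L * |x - y|) → ∃ C, ∀ n x,
          |l.P^[n] g x - (∫ x in (0 : ℝ)..1, g x) * ρ x| ≤ C * q ^ n := by
      rintro g hg hgp ⟨L, hL0, hL⟩
      obtain ⟨C, hC0, hC⟩ := exists_abs_le_of_periodic hg one_ne_zero hgp
      -- After adding `k` the function is at least `L + 1`, so its logarithm is Lipschitz with
      -- constant below `1 ≤ a`; normalised by `I`, it enters the cone.
      set k := C + L + 1 with hk
      have hpos : ∀ x, L + 1 ≤ g x + k := fun x => by linarith [neg_le_of_abs_le (hC x)]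
      set I := ∫ x in (0 : ℝ)..1, (g x + k) with hI
      have hI' : I = (∫ x in (0 : ℝ)..1, g x) + k := by
        rw [hI, intervalIntegral.integral_add (hg.intervalIntegrable _ _) (by simp)]
        simp
      have hI1 : 1 ≤ I := by
        have h1 := intervalIntegral.integral_mono_on (a := 0) (b := 1) (μ := volume) (by norm_num)
          (f := fun _ => 1) (g := fun x => g x + k) (by simp)
          (Continuous.intervalIntegrable (by fun_prop) _ _) (fun x _ => by linarith [hpos x])
        simpa using h1
      have hI0 : 0 < I := by linarith
      have hcone_g : IsConeDensity a (fun x => I⁻¹ * (g x + k)) := by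
        refine ⟨by fun_prop, fun x => by simp only [hgp x], ?_, fun x => ?_, fun x y => ?_⟩
        · rw [intervalIntegral.integral_const_mul, ← hI, inv_mul_cancel₀ hI0.ne']
        · have := hpos x
          exact mul_nonneg (inv_nonneg.2 hI0.le) (by linarith)
        · have h1 := hL x y
          have h2 := Real.add_one_le_exp (a * |x - y|)
          have h3 : g x + k ≤ Real.exp (a * |x - y|) * (g y + k) := by
            have h4 : L * |x - y| ≤ a * |x - y| * (g y + k) := by
              have : L ≤ a * (g y + k) := by nlinarith [hpos y]
              calc _ ≤ a * (g y + k) * |x - y| := by gcongr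
                _ = _ := by ring
            have := hpos y
            have h5 : (a * |x - y| + 1) * (g y + k) ≤ Real.exp (a * |x - y|) * (g y + k) := by
              gcongr
              linarith
            linarith [le_abs_self (g x - g y)]
          calc _ ≤ I⁻¹ * (Real.exp (a * |x - y|) * (g y + k)) := by gcongr
            _ = _ := by ring
      refine ⟨(I + |k|) * Real.exp a, fun n x => ?_⟩
      have h1 := hcontr n _ _ hcone_g hρ_cone x
      have h2 := hcontr n _ _ (IsConeDensity.one ha0) hρ_cone x
      rw [hiter_ρ] at h1 h2
      have h3 := l.iterate_P_add_mul (fun x => I⁻¹ * (g x + k)) (fun _ => 1) I (-k) n x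
      rw [show (fun y => I * (I⁻¹ * (g y + k)) + -k * 1) = g by ext y; field_simp; ring] at h3
      rw [h3, show (∫ x in (0 : ℝ)..1, g x) = I - k by linarith]
      set u := l.P^[n] (fun x => I⁻¹ * (g x + k)) x
      set v := l.P^[n] (fun _ => 1) x
      rw [show I * u + -k * v - (I - k) * ρ x = I * (u - ρ x) + -k * (v - ρ x) by ring]
      refine (abs_add_le _ _).trans ?_
      rw [abs_mul, abs_mul, abs_neg, abs_of_pos hI0]
      calc _ ≤ I * (Real.exp a * q ^ n) + |k| * (Real.exp a * q ^ n) := by gcongr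
        _ = _ := by ring
    intro f hf hfp ε hε
    -- Three errors of size `ε / 3`; both `P^[n] 1` and `ρ` are at most `exp a`.
    obtain ⟨η, hη⟩ : ∃ η, η = ε / (3 * Real.exp a) := ⟨_, rfl⟩
    have hη0 : 0 < η := by rw [hη]; positivity
    have hηε : η * Real.exp a = ε / 3 := by rw [hη]; field_simp
    obtain ⟨g, hg, hgp, hgl, hfg⟩ := exists_lipschitz_periodic_approx hf hfp hη0
    obtain ⟨C, hC⟩ := hlip g hg hgp hgl
    have ht : Tendsto (fun n : ℕ => C * q ^ n) atTop (𝓝 0) := by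
      simpa using (tendsto_pow_atTop_nhds_zero_of_lt_one hq0.le hq1).const_mul C
    obtain ⟨n, hn⟩ := (ht.eventually (gt_mem_nhds (show 0 < ε / 3 by positivity))).exists
    refine ⟨n, fun x => ?_⟩
    have hone : l.P^[n] (fun _ => 1) x ≤ Real.exp a := (hr_cone n).le_const ha0 x
    have h1 : |l.P^[n] f x - l.P^[n] g x| ≤ ε / 3 := by
      have u1 := l.iterate_P_mono (f := fun y => 1 * f y + (-1) * g y)
        (g := fun y => η * (fun _ => 1) y + 0 * g y)
        (fun y => by simp only; linarith [le_of_abs_le (hfg y)]) n x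
      have u2 := l.iterate_P_mono (f := fun y => (-η) * (fun _ => 1) y + 0 * g y)
        (g := fun y => 1 * f y + (-1) * g y)
        (fun y => by simp only; linarith [neg_le_of_abs_le (hfg y)]) n x
      rw [iterate_P_add_mul, iterate_P_add_mul] at u1 u2
      have u3 : η * l.P^[n] (fun _ => 1) x ≤ ε / 3 := by
        rw [← hηε]
        gcongr
      rw [abs_le]
      constructor <;> linarith
    have h2 : |(∫ x in (0 : ℝ)..1, f x) - ∫ x in (0 : ℝ)..1, g x| ≤ η := by
      rw [← intervalIntegral.integral_sub (hf.intervalIntegrable _ _) (hg.intervalIntegrable _ _)]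
      have := intervalIntegral.norm_integral_le_of_norm_le_const (a := 0) (b := 1)
        (f := fun x => f x - g x) (C := η) (fun x _ => hfg x)
      simpa using this
    have h3 : |((∫ x in (0 : ℝ)..1, f x) - ∫ x in (0 : ℝ)..1, g x) * ρ x| ≤ ε / 3 := by
      rw [abs_mul, abs_of_pos (hρ_pos x), ← hηε]
      exact mul_le_mul h2 (hρ_up x) (hρ_pos x).le hη0.le
    have h4 := (hC n x).trans hn.le
    rw [abs_le] at h1 h3 h4 ⊢
    constructor <;> linarith

end ExpandingLift

/-! ### Measures with a density on the circle -/

theorem continuous_of_continuous_coe {α : Type*} [TopologicalSpace α] {f : S1 → α}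
    (h : Continuous fun x : ℝ => f x) : Continuous f :=
  (QuotientAddGroup.isQuotientMap_mk (N := AddSubgroup.zmultiples (1 : ℝ))).continuous_iff.2 h

theorem continuous_coe : Continuous ((↑) : ℝ → S1) := AddCircle.continuous_mk' (1 : ℝ)

theorem periodic_coe {α : Type*} (f : S1 → α) : Function.Periodic (fun x : ℝ => f x) 1 := fun x => by
  simp

theorem IsCn.continuous {n : WithTop ℕ∞} {f : S1 → ℝ} (hf : IsCn n f) : Continuous f :=
  continuous_of_continuous_coe (ContDiff.continuous hf)

theorem integral_eq_intervalIntegral (f : S1 → ℝ) :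
    ∫ z : S1, f z = ∫ x in (0 : ℝ)..1, f x := by
  have := UnitAddCircle.intervalIntegral_preimage 0 f
  rw [zero_add] at this
  exact this.symm

theorem measure_ext_of_continuous {μ ν : Measure S1} [IsFiniteMeasure μ] [IsFiniteMeasure ν]
    (h : ∀ f : S1 → ℝ, Continuous f → ∫ x, f x ∂μ = ∫ x, f x ∂ν) : μ = ν :=
  ext_of_forall_integral_eq_of_IsFiniteMeasure fun f => h f f.continuous

theorem exists_bounds {ρ : S1 → ℝ} (hρ : Continuous ρ) (hpos : ∀ x, 0 < ρ x) :
    ∃ m M : ℝ, 0 < m ∧ 0 < M ∧ ∀ x, m ≤ ρ x ∧ ρ x ≤ M := by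
  obtain ⟨x₀, -, h₀⟩ := isCompact_univ.exists_isMinOn Set.univ_nonempty hρ.continuousOn
  obtain ⟨x₁, -, h₁⟩ := isCompact_univ.exists_isMaxOn Set.univ_nonempty hρ.continuousOn
  exact ⟨ρ x₀, ρ x₁, hpos _, hpos _, fun x => ⟨h₀ (Set.mem_univ x), h₁ (Set.mem_univ x)⟩⟩

/-- The measure on the circle with a given real density. -/
def dens (h : S1 → ℝ) : Measure S1 := (volume : Measure S1).withDensity fun x => ENNReal.ofReal (h x)

theorem Continuous.integrable_volume {f : S1 → ℝ} (hf : Continuous f) :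
    Integrable f (volume : Measure S1) := by
  have := BoundedContinuousFunction.integrable (volume : Measure S1)
    (BoundedContinuousFunction.mkOfCompact ⟨f, hf⟩)
  exact this

theorem isFiniteMeasure_dens {h : S1 → ℝ} (hh : Continuous h) : IsFiniteMeasure (dens h) :=
  isFiniteMeasure_withDensity_ofReal (Continuous.integrable_volume hh).2

theorem integral_dens {h : S1 → ℝ} (hh : Measurable h) (h0 : ∀ x, 0 ≤ h x) (f : S1 → ℝ) :
    ∫ x, f x ∂(dens h) = ∫ x, h x * f x := by
  rw [dens, integral_withDensity_eq_integral_toReal_smul (by fun_prop) (by simp)]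
  simp only [ENNReal.toReal_ofReal (h0 _), smul_eq_mul]

theorem map_dens_eq {H : S1 → S1} (hH : Continuous H) {h k : S1 → ℝ} (hh : Continuous h)
    (h0 : ∀ x, 0 ≤ h x) (hk : Continuous k) (k0 : ∀ x, 0 ≤ k x)
    (heq : ∀ φ : S1 → ℝ, Continuous φ → ∫ x, h x * φ (H x) = ∫ x, k x * φ x) :
    (dens h).map H = dens k := by
  have := isFiniteMeasure_dens hh
  have := isFiniteMeasure_dens hk
  refine measure_ext_of_continuous fun φ hφ => ?_
  rw [integral_map hH.aemeasurable hφ.aestronglyMeasurable, integral_dens hh.measurable h0,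
    integral_dens hk.measurable k0, heq φ hφ]

theorem dens_absolutelyContinuous (ρ : S1 → ℝ) : dens ρ ≪ volume := withDensity_absolutelyContinuous _ _

theorem volume_absolutelyContinuous_dens {ρ : S1 → ℝ} (hρ : Continuous ρ) (hpos : ∀ x, 0 < ρ x) : (volume : Measure S1) ≪ dens ρ :=
  withDensity_absolutelyContinuous' (by have := hρ.measurable; fun_prop)
    (ae_of_all _ fun x => by simpa using hpos x)

/-- The density is bounded above and below, so either measure is dominated by a multiple of the
other. -/
theorem memLp_dens_iff {ρ : S1 → ℝ} (hρ : Continuous ρ) (hpos : ∀ x, 0 < ρ x) {f : S1 → ℝ} {p : ENNReal} : MemLp f p (dens ρ) ↔ MemLp f p volume := by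
  obtain ⟨m, M, hm, hM, hb⟩ := exists_bounds hρ hpos
  constructor
  · refine MemLp.of_measure_le_smul (c := ENNReal.ofReal m⁻¹) ENNReal.ofReal_ne_top ?_
    have h1 : ENNReal.ofReal m • (volume : Measure S1) ≤ dens ρ := by
      rw [dens, ← withDensity_const]
      exact withDensity_mono (ae_of_all _ fun x => ENNReal.ofReal_le_ofReal (hb x).1)
    calc (volume : Measure S1) = (ENNReal.ofReal m⁻¹ * ENNReal.ofReal m) • volume := by
          rw [← ENNReal.ofReal_mul (by positivity), inv_mul_cancel₀ hm.ne']
          simp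
      _ ≤ _ := by
        rw [mul_smul]
        gcongr
  · refine MemLp.of_measure_le_smul (c := ENNReal.ofReal M) ENNReal.ofReal_ne_top ?_
    rw [dens, ← withDensity_const]
    exact withDensity_mono (ae_of_all _ fun x => ENNReal.ofReal_le_ofReal (hb x).2)

/-! ### The branches of an expanding map -/

namespace ExpandingLift

variable {Φ : S1 → S1} (l : ExpandingLift Φ)

theorem continuous_map (l : ExpandingLift Φ) : Continuous Φ :=
  continuous_of_continuous_coe ((continuous_coe.comp l.contDiff_F.continuous).congr
    fun x => (l.map_coe x).symm)

/-- The inverse branches of the expanding map. -/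
def branch (j : ℕ) (x : ℝ) : S1 := (l.E (x + j) : ℝ)

theorem continuous_branch (j : ℕ) : Continuous (l.branch j) := by
  have := l.continuous_E
  exact continuous_coe.comp (by fun_prop)

theorem map_branch (j : ℕ) (x : ℝ) : Φ (l.branch j x) = x := by
  rw [branch, l.map_coe, l.F_E, coe_eq_coe_iff]
  exact ⟨j, by simp⟩

theorem preimage_eq (x : ℝ) :
    Φ ⁻¹' {(x : S1)} = (((Finset.range l.N).image fun j => l.branch j x : Finset S1) : Set S1) := by
  ext z
  simp only [Set.mem_preimage, Set.mem_singleton_iff, Finset.coe_image, Set.mem_image,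
    Finset.coe_range, Set.mem_Iio]
  constructor
  · intro hz
    obtain ⟨y, rfl⟩ := QuotientAddGroup.mk_surjective z
    have h1 : ((l.F y : ℝ) : S1) = x := by rw [← l.map_coe]; exact hz
    obtain ⟨n, hn⟩ := coe_eq_coe_iff.1 h1
    have hN : (0 : ℤ) < l.N := by exact_mod_cast l.N_pos
    -- Adding a multiple of `N` to the argument of `E` moves its value by an integer, so only the
    -- residue of `n` modulo `N` selects the branch.
    refine ⟨(n % l.N).toNat, ?_, ?_⟩
    · have := Int.emod_lt_of_pos n hN
      have := Int.emod_nonneg n hN.ne'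
      omega
    · have h2 : (((n % l.N).toNat : ℕ) : ℝ) = n - (n / l.N : ℤ) * l.N := by
        have h3 : (((n % l.N).toNat : ℕ) : ℤ) = n - (n / l.N) * l.N := by
          rw [Int.toNat_of_nonneg (Int.emod_nonneg n hN.ne'), Int.emod_def]
          ring
        exact_mod_cast congrArg (Int.cast : ℤ → ℝ) h3
      rw [branch, h2]
      have h4 := l.E_add_int (l.F y) (-(n / l.N))
      rw [l.E_F, hn] at h4
      rw [show x + (n - (n / l.N : ℤ) * (l.N : ℝ)) = x + n + (-(n / l.N) : ℤ) * (l.N : ℝ) by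
        push_cast; ring, h4]
      refine coe_eq_coe_iff.2 ?_
      rcases l.s_eq with h | h <;> rw [h]
      · exact ⟨-(n / l.N), by simp⟩
      · exact ⟨n / l.N, by simp⟩
  · rintro ⟨j, -, rfl⟩
    exact l.map_branch j x

theorem branch_injOn (x : ℝ) : Set.InjOn (fun j => l.branch j x) (Finset.range l.N : Set ℕ) := by
  intro i hi j hj hij
  simp only [Finset.coe_range, Set.mem_Iio] at hi hj
  obtain ⟨n, hn⟩ := coe_eq_coe_iff.1 hij
  have h1 := congrArg l.F hn
  rw [l.F_add_int, l.F_E, l.F_E] at h1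
  obtain ⟨m, hm⟩ : ∃ m : ℤ, (m : ℝ) = n * l.s := by
    rcases l.s_eq with h | h <;> rw [h]
    · exact ⟨n, by simp⟩
    · exact ⟨-n, by simp⟩
  have h2 : (i : ℝ) = j + m * l.N := by rw [hm]; linarith
  have h3 : (i : ℤ) = j + m * l.N := by exact_mod_cast h2
  rcases lt_trichotomy m 0 with h | h | h
  · have : m * l.N ≤ -1 * l.N := by gcongr; omega
    omega
  · rw [h] at h3
    omega
  · have : 1 * (l.N : ℤ) ≤ m * l.N := by gcongr; omega
    omega

theorem finsum_preimage (k : S1 → ℝ) (x : ℝ) :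
    ∑ᶠ y ∈ Φ ⁻¹' {(x : S1)}, k y = ∑ j ∈ Finset.range l.N, k (l.branch j x) := by
  rw [l.preimage_eq, finsum_mem_coe_finset, Finset.sum_image (l.branch_injOn x)]

theorem continuous_circleDeriv (l : ExpandingLift Φ) : Continuous (circleDeriv Φ) :=
  continuous_of_continuous_coe ((l.contDiff_F.continuous_deriv (by norm_num)).congr
    fun x => (l.circleDeriv_coe x).symm)

theorem abs_circleDeriv (z : S1) : |circleDeriv Φ z| = l.s * circleDeriv Φ z := by
  obtain ⟨x, rfl⟩ := QuotientAddGroup.mk_surjective z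
  rw [l.circleDeriv_coe, l.abs_deriv]

theorem circleDeriv_eq (z : S1) : circleDeriv Φ z = l.s * |circleDeriv Φ z| := by
  rw [abs_circleDeriv, ← mul_assoc, s_mul_s, one_mul]

theorem abs_circleDeriv_le (z : S1) : |circleDeriv Φ z| ≤ l.K := by
  obtain ⟨x, rfl⟩ := QuotientAddGroup.mk_surjective z
  rw [l.circleDeriv_coe]
  exact l.abs_deriv_le x

theorem abs_circleDeriv_pos (l : ExpandingLift Φ) (z : S1) : 0 < |circleDeriv Φ z| := by
  obtain ⟨x, rfl⟩ := QuotientAddGroup.mk_surjective z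
  rw [l.circleDeriv_coe, l.abs_deriv]
  exact l.deriv_pos x

theorem sign_circleDeriv (z : S1) : Real.sign (circleDeriv Φ z) = l.s := by
  obtain ⟨x, rfl⟩ := QuotientAddGroup.mk_surjective z
  rw [l.circleDeriv_coe, l.sign_deriv]

theorem P_eq (h : S1 → ℝ) (x : ℝ) : l.P (fun y => h y) x =
    ∑ j ∈ Finset.range l.N, h (l.branch j x) / |circleDeriv Φ (l.branch j x)| := by
  refine Finset.sum_congr rfl fun j _ => ?_
  rw [branch, l.circleDeriv_coe, l.abs_deriv, l.w_eq]
  rfl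

/-- Change of variables for the inverse branches, as an identity of measures. -/
theorem sum_map_branch : ∑ j ∈ Finset.range l.N,
    (volume.restrict (Set.Ioc (0 : ℝ) 1)).map (l.branch j) = dens fun z => |circleDeriv Φ z| := by
  have hc : Continuous fun z => |circleDeriv Φ z| := l.continuous_circleDeriv.abs
  have := isFiniteMeasure_dens hc
  refine measure_ext_of_continuous fun f hf => ?_
  have hfb : ∀ j, Continuous fun x => f (l.branch j x) := fun j => hf.comp (l.continuous_branch j)
  rw [integral_finsetSum_measure fun j _ => (integrable_map_measure hf.aestronglyMeasurable
    (l.continuous_branch j).aemeasurable).2 (((hfb j).integrableOn_Ioc (a := 0) (b := 1))),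
    integral_dens hc.measurable fun x => abs_nonneg _, integral_eq_intervalIntegral,
    ← l.integral_P (h := fun x : ℝ => |circleDeriv Φ x| * f x) ((hc.mul hf).comp continuous_coe)
      (periodic_coe fun z => |circleDeriv Φ z| * f z)]
  simp only [l.P_eq fun z => |circleDeriv Φ z| * f z]
  rw [intervalIntegral.integral_congr (g := fun x => ∑ j ∈ Finset.range l.N, f (l.branch j x))
    fun x _ => Finset.sum_congr rfl fun j _ => mul_div_cancel_left₀ _
      (l.abs_circleDeriv_pos _).ne',
    intervalIntegral.integral_finsetSum fun j _ => (hfb j).intervalIntegrable _ _]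
  refine Finset.sum_congr rfl fun j _ => ?_
  rw [integral_map (l.continuous_branch j).aemeasurable hf.aestronglyMeasurable,
    intervalIntegral.integral_of_le zero_le_one]

end ExpandingLift

/-! ### Fibre sums, the area formula and push-forward of densities. -/

/-- The sum over the fibres of a circle map. -/
def fiberSum (Φ : S1 → S1) (k : S1 → ℝ) (z : S1) : ℝ := ∑ᶠ y ∈ Φ ⁻¹' {z}, k y

namespace ExpandingLift

variable {Φ : S1 → S1} (l : ExpandingLift Φ)

theorem fiberSum_coe (k : S1 → ℝ) (x : ℝ) :
    fiberSum Φ k x = ∑ j ∈ Finset.range l.N, k (l.branch j x) := l.finsum_preimage k x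

/-- A function of `Φ y` is constant on each fibre. This is the duality between fibre sums and
composition with `Φ`. -/
theorem fiberSum_mul_comp (l : ExpandingLift Φ) (k φ : S1 → ℝ) (z : S1) :
    fiberSum Φ (fun y => k y * φ (Φ y)) z = fiberSum Φ k z * φ z := by
  obtain ⟨x, rfl⟩ := QuotientAddGroup.mk_surjective z
  rw [l.fiberSum_coe, l.fiberSum_coe, Finset.sum_mul]
  simp only [l.map_branch]

end ExpandingLift

/-- The representative in `(0, 1]` of a point of the circle. -/
def toIoc (z : S1) : ℝ := (AddCircle.equivIoc (1 : ℝ) 0 z : ℝ)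

theorem coe_toIoc (z : S1) : (toIoc z : S1) = z := AddCircle.coe_equivIoc

theorem measurePreserving_toIoc :
    MeasurePreserving toIoc volume (volume.restrict (Set.Ioc (0 : ℝ) 1)) := by
  have h1 := AddCircle.measurePreserving_equivIoc (1 : ℝ) (a := 0)
  have h2 := measurePreserving_subtype_coe (μa := (volume : Measure ℝ))
    (measurableSet_Ioc (a := (0 : ℝ)) (b := 0 + 1))
  have h3 : MeasurePreserving toIoc volume (volume.restrict (Set.Ioc (0 : ℝ) (0 + 1))) :=
    h2.comp h1
  rwa [zero_add] at h3

namespace ExpandingLift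

variable {Φ : S1 → S1} (l : ExpandingLift Φ)

theorem measurable_branch_toIoc (j : ℕ) : Measurable fun z => l.branch j (toIoc z) :=
  (l.continuous_branch j).measurable.comp measurePreserving_toIoc.measurable

theorem fiberSum_eq (k : S1 → ℝ) (z : S1) :
    fiberSum Φ k z = ∑ j ∈ Finset.range l.N, k (l.branch j (toIoc z)) := by
  conv_lhs => rw [← coe_toIoc z]
  exact l.fiberSum_coe k _

theorem sum_map_branch_toIoc : ∑ j ∈ Finset.range l.N,
    (volume : Measure S1).map (fun z => l.branch j (toIoc z)) =
      dens fun z => |circleDeriv Φ z| := by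
  rw [← l.sum_map_branch]
  refine Finset.sum_congr rfl fun j _ => ?_
  rw [← measurePreserving_toIoc.map_eq, Measure.map_map (l.continuous_branch j).measurable
    measurePreserving_toIoc.measurable]
  rfl

theorem continuous_abs_circleDeriv (l : ExpandingLift Φ) :
    Continuous fun z => |circleDeriv Φ z| := l.continuous_circleDeriv.abs

/-- The image of `volume` under one branch is a summand of `dens |Φ'|`, which is comparable to
`volume`. -/
theorem integrable_comp_branch {k : S1 → ℝ} (hk : Integrable k) {j : ℕ}
    (hj : j ∈ Finset.range l.N) : Integrable fun z => k (l.branch j (toIoc z)) := by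
  have h1 : Integrable k (dens fun z => |circleDeriv Φ z|) := by
    rw [← memLp_one_iff_integrable] at hk ⊢
    exact (memLp_dens_iff l.continuous_abs_circleDeriv l.abs_circleDeriv_pos).2 hk
  rw [← l.sum_map_branch_toIoc, integrable_finsetSum_measure] at h1
  exact (h1 j hj).comp_measurable (l.measurable_branch_toIoc j)

theorem integrable_fiberSum (l : ExpandingLift Φ) {k : S1 → ℝ} (hk : Integrable k) :
    Integrable (fiberSum Φ k) := by
  rw [funext (l.fiberSum_eq k)]
  exact integrable_finsetSum _ fun j hj => l.integrable_comp_branch hk hj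

theorem integral_fiberSum (l : ExpandingLift Φ) {k : S1 → ℝ} (hk : Integrable k) :
    ∫ z, fiberSum Φ k z = ∫ z, |circleDeriv Φ z| * k z := by
  have h1 : Integrable k (dens fun z => |circleDeriv Φ z|) := by
    rw [← memLp_one_iff_integrable] at hk ⊢
    exact (memLp_dens_iff l.continuous_abs_circleDeriv l.abs_circleDeriv_pos).2 hk
  rw [← integral_dens l.continuous_abs_circleDeriv.measurable (fun z => abs_nonneg _),
    ← l.sum_map_branch_toIoc, integral_finsetSum_measure
      (by rwa [← l.sum_map_branch_toIoc, integrable_finsetSum_measure] at h1)]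
  rw [← l.sum_map_branch_toIoc, integrable_finsetSum_measure] at h1
  rw [funext (l.fiberSum_eq k), integral_finsetSum _ fun j hj => l.integrable_comp_branch hk hj]
  exact Finset.sum_congr rfl fun j hj =>
    (integral_map (l.measurable_branch_toIoc j).aemeasurable (h1 j hj).aestronglyMeasurable).symm

theorem sq_fiberSum_le (k : S1 → ℝ) (z : S1) :
    fiberSum Φ k z ^ 2 ≤ l.N * fiberSum Φ (fun y => k y ^ 2) z := by
  rw [l.fiberSum_eq, l.fiberSum_eq]
  simpa using sq_sum_le_card_mul_sum_sq (s := Finset.range l.N)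
    (f := fun j => k (l.branch j (toIoc z)))

theorem memLp_fiberSum (l : ExpandingLift Φ) {k : S1 → ℝ} (hk : MemLp k 2) :
    MemLp (fiberSum Φ k) 2 := by
  have h1 := l.integrable_fiberSum (hk.integrable one_le_two)
  rw [memLp_two_iff_integrable_sq h1.aestronglyMeasurable]
  refine ((l.integrable_fiberSum hk.integrable_sq).const_mul (l.N : ℝ)).mono'
    (h1.aestronglyMeasurable.pow 2) (ae_of_all _ fun z => ?_)
  rw [Real.norm_of_nonneg (sq_nonneg _)]
  exact l.sq_fiberSum_le k z

theorem continuous_fiberSum {k : S1 → ℝ} (hk : Continuous k) (l : ExpandingLift Φ) :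
    Continuous (fiberSum Φ k) := by
  refine continuous_of_continuous_coe ?_
  simp only [l.fiberSum_coe]
  exact continuous_finsetSum _ fun j _ => hk.comp (l.continuous_branch j)

/-- The push-forward of a measure with continuous density. -/
theorem map_dens {h : S1 → ℝ} (hh : Continuous h) (h0 : ∀ z, 0 ≤ h z) (l : ExpandingLift Φ) :
    (dens h).map Φ = dens (fiberSum Φ fun y => h y / |circleDeriv Φ y|) := by
  have hc : Continuous fun y => h y / |circleDeriv Φ y| :=
    hh.div l.continuous_abs_circleDeriv fun y => (l.abs_circleDeriv_pos y).ne'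
  refine map_dens_eq l.continuous_map hh h0 (l.continuous_fiberSum hc) (fun z => ?_)
    fun φ hφ => ?_
  · rw [l.fiberSum_eq]
    exact Finset.sum_nonneg fun j _ => div_nonneg (h0 _) (abs_nonneg _)
  · have h1 := l.integral_fiberSum (k := fun y => h y / |circleDeriv Φ y| * φ (Φ y))
      (Continuous.integrable_volume (hc.mul (hφ.comp l.continuous_map)))
    simp only [l.fiberSum_mul_comp] at h1
    rw [h1]
    refine integral_congr_ae (ae_of_all _ fun z => ?_)
    have := (l.abs_circleDeriv_pos z).ne'
    field_simp

end ExpandingLift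

/-! ### The absolutely continuous invariant measure -/

theorem eq_of_forall_abs_sub_le {a b C : ℝ} (h : ∀ η > 0, |a - b| ≤ C * η) : a = b := by
  have h1 : Tendsto (fun η : ℝ => C * η) (𝓝[>] 0) (𝓝 0) := by
    have : Tendsto (fun η : ℝ => C * η) (𝓝 0) (𝓝 (C * 0)) := (continuous_const_mul C).tendsto 0
    rw [mul_zero] at this
    exact this.mono_left nhdsWithin_le_nhds
  have h2 : |a - b| ≤ 0 := ge_of_tendsto h1 (by
    filter_upwards [self_mem_nhdsWithin] with η hη using h η hη)
  exact sub_eq_zero.1 (abs_nonpos_iff.1 h2)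

theorem isProbabilityMeasure_dens {ρ : S1 → ℝ} (hρ : Continuous ρ) (h0 : ∀ x, 0 ≤ ρ x)
    (h1 : ∫ x, ρ x = 1) : IsProbabilityMeasure (dens ρ) := by
  refine ⟨?_⟩
  rw [dens, withDensity_apply _ MeasurableSet.univ, Measure.restrict_univ,
    ← ofReal_integral_eq_lintegral_ofReal (Continuous.integrable_volume hρ) (ae_of_all _ h0), h1]
  simp

namespace ExpandingLift

variable {Φ : S1 → S1} (l : ExpandingLift Φ)

/-- `φ ∘ Φ` factors out of each branch sum, so `P` is dual to composition with `Φ`. -/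
theorem integral_comp_mul_P {h : ℝ → ℝ} (hh : Continuous h) (hp : Function.Periodic h 1)
    {φ : S1 → ℝ} (hφ : Continuous φ) :
    ∫ x in (0 : ℝ)..1, φ (Φ x) * h x = ∫ x in (0 : ℝ)..1, φ x * l.P h x := by
  rw [← l.integral_P (h := fun x : ℝ => φ (Φ x) * h x)
    (((hφ.comp l.continuous_map).comp continuous_coe).mul hh)
    ((periodic_coe fun z => φ (Φ z)).mul hp)]
  refine intervalIntegral.integral_congr fun x _ => ?_
  simp only [P, Finset.mul_sum]
  refine Finset.sum_congr rfl fun j _ => ?_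
  rw [show Φ (l.E (x + j) : ℝ) = x from l.map_branch j x, mul_assoc]

theorem continuous_iterate_P {h : ℝ → ℝ} (hh : Continuous h) (n : ℕ) : Continuous (l.P^[n] h) := by
  induction n with
  | zero => exact hh
  | succ n ih =>
    rw [Function.iterate_succ_apply']
    exact l.continuous_P ih

theorem periodic_iterate_P {h : ℝ → ℝ} (hh : Function.Periodic h 1) (n : ℕ) :
    Function.Periodic (l.P^[n] h) 1 := by
  induction n with
  | zero => exact hh
  | succ n ih =>
    rw [Function.iterate_succ_apply']
    exact l.periodic_P ih

theorem integral_iterate_mul {f : S1 → ℝ} (hf : Continuous f) {φ : S1 → ℝ} (hφ : Continuous φ)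
    (n : ℕ) :
    ∫ z, φ (Φ^[n] z) * f z = ∫ x in (0 : ℝ)..1, φ x * l.P^[n] (fun x => f x) x := by
  induction n generalizing φ with
  | zero => exact integral_eq_intervalIntegral _
  | succ n ih =>
    have h1 := ih (hφ.comp l.continuous_map)
    have h2 := l.integral_comp_mul_P (l.continuous_iterate_P (hf.comp continuous_coe) n)
      (l.periodic_iterate_P (periodic_coe f) n) hφ
    simp only [Function.iterate_succ_apply', Function.comp] at h1 h2 ⊢
    exact h1.trans h2

/-- Existence and uniqueness of the absolutely continuous invariant probability measure. -/
theorem exists_invariant_measure (l : ExpandingLift Φ) (hΦ : Measurable Φ) :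
    ∃ (μ : ProbabilityMeasure S1) (ρ : S1 → ℝ), IsCn 1 ρ ∧ (∀ x, 0 < ρ x) ∧
      (μ : Measure S1) = dens ρ ∧ (fiberSum Φ fun y => ρ y / |circleDeriv Φ y|) = ρ ∧
      ∀ ν : ProbabilityMeasure S1,
        ((ν : Measure S1) ≪ volume ∧ push Φ hΦ ν = ν) ↔ ν = μ := by
  obtain ⟨r, hr1, hrp, hr0, hrI, hrP, hdecay⟩ := l.exists_invariant_density
  set ρ : S1 → ℝ := hrp.lift with hρ_def
  have hρc : Continuous ρ := continuous_of_continuous_coe hr1.continuous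
  have hρ0 : ∀ x, 0 < ρ x := fun z => by
    obtain ⟨x, rfl⟩ := QuotientAddGroup.mk_surjective z
    exact hr0 x
  have hρI : ∫ z, ρ z = 1 := by rw [integral_eq_intervalIntegral]; exact hrI
  have hρfix : (fiberSum Φ fun y => ρ y / |circleDeriv Φ y|) = ρ := funext fun z => by
    obtain ⟨x, rfl⟩ := QuotientAddGroup.mk_surjective z
    refine (l.fiberSum_coe _ x).trans ?_
    rw [← l.P_eq ρ x]
    exact congrFun hrP x
  have hprob := isProbabilityMeasure_dens hρc (fun x => (hρ0 x).le) hρI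
  have hinv : push Φ hΦ ⟨dens ρ, hprob⟩ = ⟨dens ρ, hprob⟩ := by
    refine Subtype.ext ?_
    change (dens ρ).map Φ = dens ρ
    rw [map_dens hρc (fun z => (hρ0 z).le) l, hρfix]
  refine ⟨⟨dens ρ, hprob⟩, ρ, hr1, hρ0, rfl, hρfix, fun ν => ⟨?_, ?_⟩⟩
  · rintro ⟨hac, hν⟩
    suffices h : (ν : Measure S1) = dens ρ from Subtype.ext h
    refine measure_ext_of_continuous fun φ hφ => ?_
    obtain ⟨C, hC⟩ : ∃ C, ∀ z, |φ z| ≤ C := by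
      obtain ⟨C, hC⟩ := isCompact_univ.exists_bound_of_continuousOn hφ.continuousOn
      exact ⟨C, fun z => hC z (Set.mem_univ z)⟩
    have hC0 : 0 ≤ C := (abs_nonneg _).trans (hC 0)
    have hmp : MeasurePreserving Φ (ν : Measure S1) ν := ⟨hΦ, congrArg Subtype.val hν⟩
    set g : S1 → ℝ := fun z => ((ν : Measure S1).rnDeriv volume z).toReal with hg
    have hgi : Integrable g := Measure.integrable_toReal_rnDeriv
    have hgν : ∀ ψ : S1 → ℝ, ∫ z, ψ z ∂(ν : Measure S1) = ∫ z, g z * ψ z := fun ψ =>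
      (integral_rnDeriv_smul hac).symm
    refine eq_of_forall_abs_sub_le (C := 3 * C) fun η hη => ?_
    -- Decay is available for continuous functions only, whereas the density `g` of `ν` is merely
    -- `L¹`. The chain is `∫ φ dν = ∫ g φ∘Φⁿ ≈ ∫ f φ∘Φⁿ ≈ (∫ f)(∫ ρφ) ≈ ∫ ρφ`, with an error of at
    -- most `C * η` in each of the bounds `b1`, `b2`, `b3`.
    obtain ⟨f, hf, -⟩ := hgi.exists_boundedContinuous_integral_sub_le hη
    obtain ⟨n, hn⟩ := hdecay (fun x => f x) (f.continuous.comp continuous_coe)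
      (periodic_coe f) η hη
    have hfi : Integrable f := Continuous.integrable_volume f.continuous
    have hfi1 : ∫ x in (0 : ℝ)..1, f (x : S1) = ∫ z, f z := (integral_eq_intervalIntegral f).symm
    have hφn : Continuous fun z => φ (Φ^[n] z) := hφ.comp (l.continuous_map.iterate n)
    have hg1 : ∫ z, g z = 1 := by
      have := hgν fun _ => 1
      simpa using this.symm
    have e1 : ∫ z, φ z ∂(ν : Measure S1) = ∫ z, g z * φ (Φ^[n] z) := by
      rw [← hgν fun z => φ (Φ^[n] z)]
      have := (hmp.iterate n)
      conv_lhs => rw [← this.map_eq]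
      exact integral_map this.aemeasurable hφ.aestronglyMeasurable
    have hgn : Integrable fun z => g z * φ (Φ^[n] z) :=
      hgi.mul_bdd (c := C) hφn.aestronglyMeasurable (ae_of_all _ fun z => hC _)
    have hfn : Integrable fun z => φ (Φ^[n] z) * f z :=
      Continuous.integrable_volume (hφn.mul f.continuous)
    have abs_le_int : ∀ F G : S1 → ℝ, Integrable G → (∀ z, |F z| ≤ G z) →
        |∫ z, F z| ≤ ∫ z, G z := fun F G hG hFG => by
      have := norm_integral_le_of_norm_le (f := F) hG (ae_of_all _ hFG)
      simpa only [Real.norm_eq_abs] using this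
    have b1 : |(∫ z, g z * φ (Φ^[n] z)) - ∫ z, φ (Φ^[n] z) * f z| ≤ C * η := by
      rw [← integral_sub hgn hfn]
      calc _ ≤ ∫ z, C * |g z - f z| := by
            refine abs_le_int _ _ ((hgi.sub hfi).abs.const_mul C) fun z => ?_
            rw [show g z * φ (Φ^[n] z) - φ (Φ^[n] z) * f z = φ (Φ^[n] z) * (g z - f z) by ring,
              abs_mul]
            exact mul_le_mul_of_nonneg_right (hC _) (abs_nonneg _)
        _ = C * ∫ z, |g z - f z| := integral_const_mul _ _
        _ ≤ C * η := mul_le_mul_of_nonneg_left hf hC0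
    have b2 : |(∫ z, φ (Φ^[n] z) * f z) - (∫ z, f z) * ∫ z, ρ z * φ z| ≤ C * η := by
      rw [l.integral_iterate_mul f.continuous hφ, integral_eq_intervalIntegral (fun z => ρ z * φ z),
        ← intervalIntegral.integral_const_mul, ← intervalIntegral.integral_sub]
      · have := intervalIntegral.norm_integral_le_of_norm_le_const (a := 0) (b := 1) (C := C * η)
          (f := fun x : ℝ => φ x * l.P^[n] (fun x => f x) x - (∫ z, f z) * (ρ x * φ x))
          fun x _ => by
            rw [show φ x * l.P^[n] (fun x => f x) x - (∫ z, f z) * (ρ x * φ x) =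
              φ x * (l.P^[n] (fun x => f x) x - (∫ z, f z) * ρ x) by ring, norm_mul]
            have h2 := hn x
            rw [hfi1] at h2
            exact mul_le_mul (hC _) h2 (abs_nonneg _) hC0
        simpa using this
      · exact ((hφ.comp continuous_coe).mul (l.continuous_iterate_P
          (f.continuous.comp continuous_coe) n)).intervalIntegrable _ _
      · exact (continuous_const.mul ((hρc.mul hφ).comp continuous_coe)).intervalIntegrable _ _
    have b3 : |((∫ z, f z) - 1) * ∫ z, ρ z * φ z| ≤ C * η := by
      rw [abs_mul, mul_comm]
      refine mul_le_mul ?_ ?_ (abs_nonneg _) hC0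
      · calc _ ≤ ∫ z, C * ρ z := by
              refine abs_le_int _ _ ((Continuous.integrable_volume hρc).const_mul C) fun z => ?_
              rw [abs_mul, mul_comm, abs_of_pos (hρ0 z)]
              exact mul_le_mul_of_nonneg_right (hC _) (hρ0 z).le
          _ = C := by rw [integral_const_mul, hρI, mul_one]
      · calc |(∫ z, f z) - 1| = |∫ z, (g z - f z)| := by
              rw [integral_sub hgi hfi, hg1, abs_sub_comm]
          _ ≤ ∫ z, |g z - f z| := abs_integral_le_integral_abs
          _ ≤ η := hf
    rw [e1]
    change |_ - ∫ z, φ z ∂(dens ρ)| ≤ _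
    rw [integral_dens hρc.measurable (fun z => (hρ0 z).le)]
    have h3 : ((∫ z, f z) - 1) * ∫ z, ρ z * φ z =
      (∫ z, f z) * (∫ z, ρ z * φ z) - ∫ z, ρ z * φ z := by ring
    rw [h3] at b3
    rw [abs_le] at b1 b2 b3 ⊢
    constructor <;> linarith
  · rintro rfl
    exact ⟨dens_absolutelyContinuous ρ, hinv⟩

end ExpandingLift

/-! ### Gradients and square integrable vector fields -/

theorem grad_coe (f : S1 → ℝ) (x : ℝ) : grad f x = deriv (fun y : ℝ => f y) x := by
  have h := deriv_comp_const_add (f := fun y : ℝ => f y) x 0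
  simpa [grad] using h

theorem IsCn.continuous_grad {n : WithTop ℕ∞} {f : S1 → ℝ} (hn : 1 ≤ n) (hf : IsCn n f) :
    Continuous (grad f) :=
  continuous_of_continuous_coe (((ContDiff.of_le hf hn).continuous_deriv le_rfl).congr
    fun x => (grad_coe f x).symm)

theorem IsCn.integral_grad {n : WithTop ℕ∞} {f : S1 → ℝ} (hn : 1 ≤ n) (hf : IsCn n f) :
    ∫ z, grad f z = 0 := by
  have h1 : ContDiff ℝ 1 fun x : ℝ => f x := ContDiff.of_le hf hn
  rw [integral_eq_intervalIntegral]
  simp only [grad_coe]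
  rw [intervalIntegral.integral_deriv_eq_sub
    (fun x _ => (h1.differentiable one_ne_zero) x)
    ((h1.continuous_deriv le_rfl).intervalIntegrable _ _), sub_eq_zero]
  simpa using periodic_coe f 0

theorem contDiff_fourier (n : ℤ) : ContDiff ℝ ⊤ fun x : ℝ => (fourier n (x : S1) : ℂ) := by
  simp only [fourier_coe_apply]
  have h : ContDiff ℝ ⊤ fun x : ℝ => (x : ℂ) := Complex.ofRealCLM.contDiff
  fun_prop

theorem volume_eq_haarAddCircle : (volume : Measure S1) = AddCircle.haarAddCircle := by
  rw [AddCircle.volume_eq_smul_haarAddCircle]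
  simp

/-- A square integrable function orthogonal to all derivatives is constant. -/
theorem ae_eq_const_of_integral_mul_grad {k : S1 → ℝ} (hk : MemLp k 2)
    (h : ∀ f : S1 → ℝ, IsCn ((⊤ : ℕ∞) : WithTop ℕ∞) f → ∫ z, k z * grad f z = 0) :
    ∃ c : ℝ, k =ᵐ[volume] fun _ => c := by
  -- Subtracting the mean disposes of the zeroth Fourier coefficient and leaves the orthogonality to
  -- derivatives intact.
  set c := ∫ z, k z with hc
  have hki : Integrable k := hk.integrable one_le_two
  have hk' : MemLp (fun z => k z - c) 2 (volume : Measure S1) := hk.sub (memLp_const c)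
  have hki' : Integrable (fun z => k z - c) (volume : Measure S1) := hk'.integrable one_le_two
  have h' : ∀ f : S1 → ℝ, IsCn ((⊤ : ℕ∞) : WithTop ℕ∞) f → ∫ z, (k z - c) * grad f z = 0 := by
    intro f hf
    have hcg := hf.continuous_grad (by simp)
    obtain ⟨C, hC⟩ := isCompact_univ.exists_bound_of_continuousOn hcg.continuousOn
    simp only [sub_mul]
    rw [integral_sub (hki.mul_bdd (c := C) hcg.aestronglyMeasurable
      (ae_of_all _ fun z => hC z (Set.mem_univ z)))
      ((Continuous.integrable_volume hcg).const_mul c), h f hf, integral_const_mul,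
      hf.integral_grad (by simp)]
    simp
  have hK : MemLp (fun z => ((k z - c : ℝ) : ℂ)) 2 AddCircle.haarAddCircle := by
    rw [← volume_eq_haarAddCircle]
    exact hk'.ofReal
  have hcoef : ∀ n : ℤ, ∫ z : S1, fourier n z * ((k z - c : ℝ) : ℂ) = 0 := by
    intro n
    have hint : Integrable (fun z : S1 => fourier n z * ((k z - c : ℝ) : ℂ)) :=
      hki'.ofReal.bdd_mul (c := 1) (fourier n).continuous.aestronglyMeasurable
        (ae_of_all _ fun z => ((fourier n).norm_coe_le_norm z).trans_eq (fourier_norm n))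
    have hder : ∀ x : ℝ, HasDerivAt (fun y : ℝ => fourier n (y : S1))
        (2 * Real.pi * Complex.I * n * fourier n (x : S1)) x := fun x => by
      have := hasDerivAt_fourier 1 n x
      simpa using this
    have hre := Complex.reCLM.integral_comp_comm hint
    have him := Complex.imCLM.integral_comp_comm hint
    simp only [Complex.reCLM_apply, Complex.imCLM_apply, Complex.re_mul_ofReal,
      Complex.im_mul_ofReal] at hre him
    by_cases hn : n = 0
    · subst hn
      simp only [fourier_zero, one_mul]
      rw [integral_complex_ofReal, integral_sub hki (integrable_const c)]
      simp [hc, Measure.real]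
    -- For `n ≠ 0` the real and imaginary parts of the character are, up to the factor `± 2πn`, each
    -- other's derivatives, so both integrals vanish.
    · have hn' : (2 * Real.pi * n : ℝ) ≠ 0 := by
        have : (n : ℝ) ≠ 0 := by exact_mod_cast hn
        positivity
      have g1 : ∀ z : S1, grad (fun z => (fourier n z : ℂ).re) z =
          -(2 * Real.pi * n) * (fourier n z : ℂ).im := fun z => by
        obtain ⟨x, rfl⟩ := QuotientAddGroup.mk_surjective z
        refine (grad_coe _ x).trans ?_
        have := (Complex.reCLM.hasFDerivAt.comp_hasDerivAt x (hder x)).deriv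
        refine this.trans ?_
        simp [Complex.mul_re, Complex.mul_im]
      have g2 : ∀ z : S1, grad (fun z => (fourier n z : ℂ).im) z =
          (2 * Real.pi * n) * (fourier n z : ℂ).re := fun z => by
        obtain ⟨x, rfl⟩ := QuotientAddGroup.mk_surjective z
        refine (grad_coe _ x).trans ?_
        have := (Complex.imCLM.hasFDerivAt.comp_hasDerivAt x (hder x)).deriv
        refine this.trans ?_
        simp [Complex.mul_re, Complex.mul_im]
      have i1 := h' (fun z => (fourier n z : ℂ).re)
        ((Complex.reCLM.contDiff.comp (contDiff_fourier n)).of_le le_top)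
      have i2 := h' (fun z => (fourier n z : ℂ).im)
        ((Complex.imCLM.contDiff.comp (contDiff_fourier n)).of_le le_top)
      simp only [g1, g2] at i1 i2
      have j1 : ∫ z : S1, (fourier n z : ℂ).im * (k z - c) = 0 := by
        have : ∀ z : S1, (k z - c) * (-(2 * Real.pi * n) * (fourier n z : ℂ).im) =
          -(2 * Real.pi * n) * ((fourier n z : ℂ).im * (k z - c)) := fun z => by ring
        simp only [this] at i1
        rw [integral_const_mul] at i1
        exact (mul_eq_zero.1 i1).resolve_left (neg_ne_zero.2 hn')
      have j2 : ∫ z : S1, (fourier n z : ℂ).re * (k z - c) = 0 := by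
        have : ∀ z : S1, (k z - c) * ((2 * Real.pi * n) * (fourier n z : ℂ).re) =
          (2 * Real.pi * n) * ((fourier n z : ℂ).re * (k z - c)) := fun z => by ring
        simp only [this] at i2
        rw [integral_const_mul] at i2
        exact (mul_eq_zero.1 i2).resolve_left hn'
      apply Complex.ext
      · rw [← hre, j2, Complex.zero_re]
      · rw [← him, j1, Complex.zero_im]
  have hzero : hK.toLp = 0 := by
    apply (fourierBasis (T := (1 : ℝ))).repr.injective
    rw [map_zero]
    ext n
    rw [fourierBasis_repr, fourierCoeff_congr_ae hK.coeFn_toLp, fourierCoeff,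
      ← volume_eq_haarAddCircle]
    exact hcoef (-n)
  have hae : (fun z => ((k z - c : ℝ) : ℂ)) =ᵐ[volume] 0 := by
    rw [volume_eq_haarAddCircle]
    exact hK.coeFn_toLp.symm.trans (hzero ▸ Lp.coeFn_zero _ _ _)
  refine ⟨c, hae.mono fun z hz => ?_⟩
  have : k z - c = 0 := Complex.ofReal_eq_zero.1 hz
  linarith

/-- `μ` has a positive continuous density `ρ` on the circle. -/
structure HasDensity (μ : ProbabilityMeasure S1) (ρ : S1 → ℝ) : Prop where
  continuous : Continuous ρ
  pos : ∀ x, 0 < ρ x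
  eq_dens : (μ : Measure S1) = dens ρ

namespace HasDensity

variable {μ : ProbabilityMeasure S1} {ρ : S1 → ℝ}

theorem integral_eq (h : HasDensity μ ρ) (f : S1 → ℝ) :
    ∫ x, f x ∂(μ : Measure S1) = ∫ x, ρ x * f x := by
  rw [h.eq_dens, integral_dens h.continuous.measurable fun x => (h.pos x).le]

theorem memLp_iff (h : HasDensity μ ρ) {f : S1 → ℝ} {p : ENNReal} :
    MemLp f p (μ : Measure S1) ↔ MemLp f p volume := by
  rw [h.eq_dens, memLp_dens_iff h.continuous h.pos]

theorem ae_eq (h : HasDensity μ ρ) : ae (μ : Measure S1) = ae (volume : Measure S1) := by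
  rw [h.eq_dens]
  exact le_antisymm (dens_absolutelyContinuous ρ).ae_le
    (volume_absolutelyContinuous_dens h.continuous h.pos).ae_le

theorem memLp_volume (h : HasDensity μ ρ) (v : Lp ℝ 2 (μ : Measure S1)) :
    MemLp v 2 (volume : Measure S1) := h.memLp_iff.1 (Lp.memLp v)

theorem integrable_volume (h : HasDensity μ ρ) (v : Lp ℝ 2 (μ : Measure S1)) :
    Integrable v (volume : Measure S1) := (h.memLp_volume v).integrable one_le_two

theorem inner_eq (h : HasDensity μ ρ) (v w : Lp ℝ 2 (μ : Measure S1)) :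
    inner ℝ v w = ∫ x, ρ x * (v x * w x) := by
  rw [L2.inner_def, h.integral_eq]
  simp [mul_comm]

theorem memLp_of_continuous (h : HasDensity μ ρ) {f : S1 → ℝ} (hf : Continuous f)
    {p : ENNReal} : MemLp f p (μ : Measure S1) := by
  rw [h.memLp_iff]
  obtain ⟨C, hC⟩ := isCompact_univ.exists_bound_of_continuousOn hf.continuousOn
  exact MemLp.of_bound hf.aestronglyMeasurable C (ae_of_all _ fun z => hC z (Set.mem_univ z))

theorem continuous_inv (h : HasDensity μ ρ) : Continuous fun x => 1 / ρ x :=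
  continuous_const.div h.continuous fun x => (h.pos x).ne'

/-- `L²_0(μ)` is the space of square integrable vector fields of Lebesgue mean zero. -/
theorem mem_L20_iff (h : HasDensity μ ρ) (v : Lp ℝ 2 (μ : Measure S1)) :
    v ∈ L20 μ ↔ ∫ x : S1, v x = 0 := by
  -- The field `1/ρ`, which represents the Lebesgue integral in `L²(μ)`.
  set e : Lp ℝ 2 (μ : Measure S1) := (h.memLp_of_continuous h.continuous_inv).toLp with he
  have hee : e =ᵐ[volume] fun x => 1 / ρ x := by
    rw [Filter.EventuallyEq, ← h.ae_eq]
    exact MemLp.coeFn_toLp _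
  have hinner : ∀ v : Lp ℝ 2 (μ : Measure S1), inner ℝ e v = ∫ x : S1, v x := fun v => by
    rw [h.inner_eq]
    refine integral_congr_ae (hee.mono fun x hx => ?_)
    have := (h.pos x).ne'
    simp only [hx]
    field_simp
  set S : Submodule ℝ (Lp ℝ 2 (μ : Measure S1)) :=
    Submodule.span ℝ {v : Lp ℝ 2 (μ : Measure S1) |
      ∃ f : S1 → ℝ, IsCn ((⊤ : ℕ∞) : WithTop ℕ∞) f ∧ v =ᵐ[(μ : Measure S1)] grad f} with hS
  -- With the closure as a double orthogonal complement, it remains to see that any `w` orthogonal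
  -- to the gradients has `ρ * w` constant.
  have hL : L20 μ = Sᗮᗮ := (Submodule.orthogonal_orthogonal_eq_closure S).symm
  have heS : e ∈ Sᗮ := by
    rw [Submodule.mem_orthogonal']
    intro g hg
    suffices hle : S ≤ LinearMap.ker (innerSL ℝ e).toLinearMap from hle hg
    refine Submodule.span_le.2 ?_
    rintro g ⟨f, hf, hgf⟩
    change inner ℝ e g = 0
    rw [hinner, ← hf.integral_grad (by simp)]
    rw [Filter.EventuallyEq, h.ae_eq] at hgf
    exact integral_congr_ae hgf
  rw [hL, Submodule.mem_orthogonal]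
  constructor
  · intro hv
    rw [← hinner]
    exact hv e heS
  · intro hv w hw
    rw [Submodule.mem_orthogonal'] at hw
    obtain ⟨C, hC⟩ := isCompact_univ.exists_bound_of_continuousOn h.continuous.continuousOn
    have hk : MemLp (fun z => ρ z * w z) 2 (volume : Measure S1) :=
      (h.memLp_volume w).of_le_mul (c := C)
        (h.continuous.aestronglyMeasurable.mul (h.memLp_volume w).1)
        (ae_of_all _ fun z => by
          rw [norm_mul]
          exact mul_le_mul_of_nonneg_right (hC z (Set.mem_univ z)) (norm_nonneg _))
    obtain ⟨c, hc⟩ := ae_eq_const_of_integral_mul_grad hk fun f hf => by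
      have hg := h.memLp_of_continuous (p := 2) (hf.continuous_grad (by simp))
      have h1 := hw hg.toLp (Submodule.subset_span ⟨f, hf, hg.coeFn_toLp⟩)
      rw [h.inner_eq] at h1
      rw [← h1]
      have h2 := hg.coeFn_toLp
      rw [Filter.EventuallyEq, h.ae_eq] at h2
      refine integral_congr_ae (h2.mono fun x hx => ?_)
      simp only [hx]
      ring
    rw [h.inner_eq]
    calc ∫ x, ρ x * (w x * v x) = ∫ x, c * v x := by
          refine integral_congr_ae (hc.mono fun x hx => ?_)
          simp only [← hx]
          ring
      _ = 0 := by rw [integral_const_mul, hv, mul_zero]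

end HasDensity

/-! ### The derivative operator and its adjoint -/

namespace ExpandingLift

variable {Φ : S1 → S1} (l : ExpandingLift Φ) {μ : ProbabilityMeasure S1} {ρ : S1 → ℝ}

theorem memLp_mul_comp (l : ExpandingLift Φ)
    (hmp : MeasurePreserving Φ (μ : Measure S1) μ)
    (u : Lp ℝ 2 (μ : Measure S1)) :
    MemLp (fun z => circleDeriv Φ z * u (Φ z)) 2 (μ : Measure S1) := by
  have h1 : MemLp (fun z => u (Φ z)) 2 (μ : Measure S1) := (Lp.memLp u).comp_measurePreserving hmp
  refine h1.of_le_mul (c := l.K) (l.continuous_circleDeriv.aestronglyMeasurable.mul h1.1)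
    (ae_of_all _ fun z => ?_)
  rw [norm_mul]
  exact mul_le_mul_of_nonneg_right (l.abs_circleDeriv_le z) (norm_nonneg _)

/-- The Koopman-type operator `u ↦ Φ' · u ∘ Φ` on `L²(μ)`. -/
def koopman (hmp : MeasurePreserving Φ (μ : Measure S1) μ) :
    Lp ℝ 2 (μ : Measure S1) →L[ℝ] Lp ℝ 2 (μ : Measure S1) :=
  LinearMap.mkContinuous
    { toFun := fun u => (l.memLp_mul_comp hmp u).toLp
      map_add' := fun u v => by
        apply Lp.ext
        have huv := hmp.quasiMeasurePreserving.ae_eq_comp (Lp.coeFn_add u v)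
        filter_upwards [(l.memLp_mul_comp hmp (u + v)).coeFn_toLp,
          (l.memLp_mul_comp hmp u).coeFn_toLp, (l.memLp_mul_comp hmp v).coeFn_toLp,
          Lp.coeFn_add (l.memLp_mul_comp hmp u).toLp (l.memLp_mul_comp hmp v).toLp, huv]
          with z h1 h2 h3 h4 h5
        simp only [Function.comp, Pi.add_apply] at h5
        rw [h1, h4, Pi.add_apply, h2, h3, h5]
        ring
      map_smul' := fun a u => by
        apply Lp.ext
        have hu := hmp.quasiMeasurePreserving.ae_eq_comp (Lp.coeFn_smul a u)
        filter_upwards [(l.memLp_mul_comp hmp (a • u)).coeFn_toLp,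
          (l.memLp_mul_comp hmp u).coeFn_toLp,
          Lp.coeFn_smul a (l.memLp_mul_comp hmp u).toLp, hu]
          with z h1 h2 h3 h4
        simp only [Function.comp, Pi.smul_apply, smul_eq_mul] at h4
        simp only [RingHom.id_apply]
        rw [h1, h3, Pi.smul_apply, h2, h4, smul_eq_mul]
        ring } l.K fun u => by
    rw [← Lp.norm_compMeasurePreserving u hmp]
    refine Lp.norm_le_mul_norm_of_ae_le_mul ?_
    filter_upwards [(l.memLp_mul_comp hmp u).coeFn_toLp, Lp.coeFn_compMeasurePreserving u hmp]
      with z h1 h2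
    change ‖((l.memLp_mul_comp hmp u).toLp : S1 → ℝ) z‖ ≤ _
    rw [h1, h2, norm_mul]
    exact mul_le_mul_of_nonneg_right (l.abs_circleDeriv_le z) (norm_nonneg _)

theorem coeFn_koopman (hmp : MeasurePreserving Φ (μ : Measure S1) μ)
    (u : Lp ℝ 2 (μ : Measure S1)) :
    l.koopman hmp u =ᵐ[(μ : Measure S1)] fun z => circleDeriv Φ z * u (Φ z) :=
  (l.memLp_mul_comp hmp u).coeFn_toLp

theorem integral_circleDeriv_mul (l : ExpandingLift Φ) {k : S1 → ℝ} (hk : Integrable k) :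
    ∫ z, circleDeriv Φ z * k z = ∫ z, fiberSum Φ (fun y => l.s * k y) z := by
  rw [l.integral_fiberSum (hk.const_mul _)]
  refine integral_congr_ae (ae_of_all _ fun z => ?_)
  simp only
  rw [l.circleDeriv_eq z, ← l.circleDeriv_eq z]
  conv_lhs => rw [l.circleDeriv_eq z]
  ring

/-- The Lebesgue integral of `Φ' · u ∘ Φ` is the degree `N * s` times that of `u`. -/
theorem koopman_mem (h : HasDensity μ ρ) (hmp : MeasurePreserving Φ (μ : Measure S1) μ)
    {u : Lp ℝ 2 (μ : Measure S1)} (hu : u ∈ L20 μ) : l.koopman hmp u ∈ L20 μ := by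
  rw [h.mem_L20_iff] at hu ⊢
  have h1 : Integrable (fun z => u (Φ z)) (volume : Measure S1) :=
    (h.memLp_iff.1 ((Lp.memLp u).comp_measurePreserving hmp)).integrable one_le_two
  have h2 := l.coeFn_koopman hmp u
  rw [Filter.EventuallyEq, h.ae_eq] at h2
  rw [integral_congr_ae h2, l.integral_circleDeriv_mul h1]
  simp only [l.fiberSum_mul_comp (fun _ => l.s) u]
  have h3 : ∀ z, fiberSum Φ (fun _ => l.s) z = l.N * l.s := fun z => by
    rw [l.fiberSum_eq]
    simp
  simp only [h3]
  rw [integral_const_mul, hu, mul_zero]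

/-- The adjoint of the derivative on `L²_0(μ)`. -/
def koopmanL20 (h : HasDensity μ ρ) (hmp : MeasurePreserving Φ (μ : Measure S1) μ) :
    L20 μ →L[ℝ] L20 μ :=
  ((l.koopman hmp).comp (L20 μ).subtypeL).codRestrict (L20 μ)
    fun u => l.koopman_mem h hmp u.2

/-- The derivative of the push-forward map on `L²_0(μ)`. -/
def derivL20 (h : HasDensity μ ρ) (hmp : MeasurePreserving Φ (μ : Measure S1) μ) :
    L20 μ →L[ℝ] L20 μ := ContinuousLinearMap.adjoint (l.koopmanL20 h hmp)

theorem adjoint_derivL20 (h : HasDensity μ ρ) (hmp : MeasurePreserving Φ (μ : Measure S1) μ)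
    (u : L20 μ) :
    ((ContinuousLinearMap.adjoint (l.derivL20 h hmp) u : Lp ℝ 2 (μ : Measure S1)) : S1 → ℝ)
      =ᵐ[(μ : Measure S1)] fun x => circleDeriv Φ x * (u : Lp ℝ 2 (μ : Measure S1)) (Φ x) := by
  rw [derivL20, ContinuousLinearMap.adjoint_adjoint]
  exact l.coeFn_koopman hmp u

/-- The explicit expression of the derivative. -/
def derivFormula (Φ : S1 → S1) (ρ v : S1 → ℝ) (x : S1) : ℝ :=
  (∑ᶠ y ∈ Φ ⁻¹' {x}, Real.sign (circleDeriv Φ y) * (ρ y / ρ x) * v y) -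
    (∫ y : S1, v y * circleDeriv Φ y * (ρ y / ρ (Φ y))) / (ρ x * ∫ y : S1, 1 / ρ y)

theorem derivFormula_eq (ρ v : S1 → ℝ) (x : S1) : derivFormula Φ ρ v x =
    fiberSum Φ (fun y => l.s * ρ y * v y) x * (1 / ρ x) -
      (∫ y : S1, v y * circleDeriv Φ y * (ρ y / ρ (Φ y))) / (∫ y : S1, 1 / ρ y) * (1 / ρ x) := by
  rw [derivFormula]
  congr 1
  · rw [← l.fiberSum_mul_comp (fun y => l.s * ρ y * v y) fun x => 1 / ρ x, fiberSum]
    refine finsum_mem_congr rfl fun y hy => ?_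
    rw [show Φ y = x from hy, l.sign_circleDeriv]
    ring
  · rw [mul_comm (ρ x), ← div_div, mul_one_div]

theorem memLp_bdd_mul {a f : S1 → ℝ} (ha : Continuous a)
    (hf : MemLp f 2 (volume : Measure S1)) : MemLp (fun z => a z * f z) 2 (volume : Measure S1) := by
  obtain ⟨C, hC⟩ := isCompact_univ.exists_bound_of_continuousOn ha.continuousOn
  refine hf.of_le_mul (c := C) (ha.aestronglyMeasurable.mul hf.1) (ae_of_all _ fun z => ?_)
  rw [norm_mul]
  exact mul_le_mul_of_nonneg_right (hC z (Set.mem_univ z)) (norm_nonneg _)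

theorem memLp_derivFormula (l : ExpandingLift Φ) (h : HasDensity μ ρ) {v : S1 → ℝ}
    (hv : MemLp v 2 (volume : Measure S1)) : MemLp (derivFormula Φ ρ v) 2 (volume : Measure S1) := by
  rw [funext (l.derivFormula_eq ρ v)]
  have h1 : MemLp (fun y => l.s * ρ y * v y) 2 (volume : Measure S1) :=
    memLp_bdd_mul (continuous_const.mul h.continuous) hv
  have h2 := memLp_bdd_mul h.continuous_inv (l.memLp_fiberSum h1)
  simp only [mul_comm (1 / ρ _)] at h2
  exact h2.sub ((h.memLp_iff.1 (h.memLp_of_continuous h.continuous_inv)).const_mul _)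

theorem integral_inv_pos (h : HasDensity μ ρ) : 0 < ∫ y : S1, 1 / ρ y := by
  obtain ⟨m, M, hm, hM, hb⟩ := exists_bounds h.continuous h.pos
  have h1 := integral_mono (integrable_const (1 / M))
    (Continuous.integrable_volume h.continuous_inv) (μ := (volume : Measure S1)) fun x =>
      one_div_le_one_div_of_le (h.pos x) (hb x).2
  refine lt_of_lt_of_le ?_ h1
  simp [Measure.real, hM]

/-- By the signed area formula, the fibre sum divided by `ρ` has the same integral as `v Φ' ρ /
ρ∘Φ`, and the multiple of `1/ρ` subtracted has exactly this integral. -/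
theorem integral_derivFormula (l : ExpandingLift Φ) (h : HasDensity μ ρ) {v : S1 → ℝ}
    (hv : MemLp v 2 (volume : Measure S1)) : ∫ x, derivFormula Φ ρ v x = 0 := by
  simp only [l.derivFormula_eq ρ v]
  have h1 : MemLp (fun y => l.s * ρ y * v y) 2 (volume : Measure S1) :=
    memLp_bdd_mul (continuous_const.mul h.continuous) hv
  have h2 := memLp_bdd_mul h.continuous_inv (l.memLp_fiberSum h1)
  simp only [mul_comm (1 / ρ _)] at h2
  have hc : Continuous fun y => ρ y / ρ (Φ y) :=
    h.continuous.div (h.continuous.comp l.continuous_map) fun x => (h.pos _).ne'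
  rw [integral_sub (h2.integrable one_le_two)
    ((Continuous.integrable_volume h.continuous_inv).const_mul _), integral_const_mul,
    div_mul_cancel₀ _ (integral_inv_pos h).ne', sub_eq_zero]
  have h3 := l.integral_circleDeriv_mul ((memLp_bdd_mul hc hv).integrable one_le_two)
  have h4 : ∀ y, l.s * (ρ y / ρ (Φ y) * v y) = l.s * ρ y * v y * (1 / ρ (Φ y)) := fun y => by ring
  simp only [h4] at h3
  simp only [l.fiberSum_mul_comp (fun y => l.s * ρ y * v y) fun x => 1 / ρ x] at h3
  rw [← h3]
  exact integral_congr_ae (ae_of_all _ fun y => by ring)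

/-- It suffices to compare inner products with every `u` in `L²_0`. The fibre sum comes from
duality; the `1/ρ` term pairs to a multiple of `∫ u = 0`, yet is needed for the formula to define an
element of `L²_0`. -/
theorem coeFn_derivL20 (h : HasDensity μ ρ) (hmp : MeasurePreserving Φ (μ : Measure S1) μ)
    (v : L20 μ) :
    ((l.derivL20 h hmp v : Lp ℝ 2 (μ : Measure S1)) : S1 → ℝ)
      =ᵐ[(μ : Measure S1)] derivFormula Φ ρ (v : Lp ℝ 2 (μ : Measure S1)) := by
  have hv := h.memLp_volume v
  have hℓ : MemLp (derivFormula Φ ρ (v : Lp ℝ 2 (μ : Measure S1))) 2 (μ : Measure S1) :=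
    h.memLp_iff.2 (l.memLp_derivFormula h hv)
  have hco : hℓ.toLp =ᵐ[volume] derivFormula Φ ρ (v : Lp ℝ 2 (μ : Measure S1)) := by
    rw [Filter.EventuallyEq, ← h.ae_eq]
    exact hℓ.coeFn_toLp
  have hmem : hℓ.toLp ∈ L20 μ := by
    rw [h.mem_L20_iff, integral_congr_ae hco, l.integral_derivFormula h hv]
  suffices heq : l.derivL20 h hmp v = ⟨hℓ.toLp, hmem⟩ by
    rw [heq]
    exact hℓ.coeFn_toLp
  refine ext_inner_right ℝ fun u => ?_
  rw [derivL20, ContinuousLinearMap.adjoint_inner_left]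
  change inner ℝ (v : Lp ℝ 2 (μ : Measure S1)) (l.koopman hmp u) =
    inner ℝ hℓ.toLp (u : Lp ℝ 2 (μ : Measure S1))
  rw [h.inner_eq, h.inner_eq]
  have hu := h.memLp_volume u
  have hu0 := (h.mem_L20_iff u).1 u.2
  have hk := l.coeFn_koopman hmp u
  rw [Filter.EventuallyEq, h.ae_eq] at hk
  have huΦ : MemLp (fun z => (u : Lp ℝ 2 (μ : Measure S1)) (Φ z)) 2 (volume : Measure S1) :=
    h.memLp_iff.1 ((Lp.memLp (u : Lp ℝ 2 (μ : Measure S1))).comp_measurePreserving hmp)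
  have h1 : MemLp (fun y => ρ y * (v : Lp ℝ 2 (μ : Measure S1)) y) 2 (volume : Measure S1) :=
    memLp_bdd_mul h.continuous hv
  have h1' : MemLp (fun y => l.s * ρ y * (v : Lp ℝ 2 (μ : Measure S1)) y) 2
      (volume : Measure S1) := memLp_bdd_mul (continuous_const.mul h.continuous) hv
  have h2 := l.integral_circleDeriv_mul (h1.integrable_mul huΦ)
  have h3 : ∀ y, l.s * (((fun y => ρ y * (v : Lp ℝ 2 (μ : Measure S1)) y) *
      fun z => (u : Lp ℝ 2 (μ : Measure S1)) (Φ z)) y) =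
      l.s * ρ y * (v : Lp ℝ 2 (μ : Measure S1)) y * (u : Lp ℝ 2 (μ : Measure S1)) (Φ y) :=
    fun y => by simp only [Pi.mul_apply]; ring
  simp only [h3] at h2
  simp only [l.fiberSum_mul_comp (fun y => l.s * ρ y * (v : Lp ℝ 2 (μ : Measure S1)) y)
    (u : Lp ℝ 2 (μ : Measure S1))] at h2
  calc _ = ∫ z, circleDeriv Φ z * ((fun y => ρ y * (v : Lp ℝ 2 (μ : Measure S1)) y) *
      fun z => (u : Lp ℝ 2 (μ : Measure S1)) (Φ z)) z := by
        refine integral_congr_ae (hk.mono fun z hz => ?_)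
        simp only [hz, Pi.mul_apply]
        ring
    _ = (∫ z, fiberSum Φ (fun y => l.s * ρ y * (v : Lp ℝ 2 (μ : Measure S1)) y) z *
          (u : Lp ℝ 2 (μ : Measure S1)) z) -
        ∫ z, (∫ y : S1, (v : Lp ℝ 2 (μ : Measure S1)) y * circleDeriv Φ y * (ρ y / ρ (Φ y))) /
          (∫ y : S1, 1 / ρ y) * (u : Lp ℝ 2 (μ : Measure S1)) z := by
        rw [h2, integral_const_mul, hu0, mul_zero, sub_zero]
    _ = _ := by
        have hint : Integrable (fun z =>
            fiberSum Φ (fun y => l.s * ρ y * (v : Lp ℝ 2 (μ : Measure S1)) y) z *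
              (u : Lp ℝ 2 (μ : Measure S1)) z) := (l.memLp_fiberSum h1').integrable_mul hu
        rw [← integral_sub hint
          ((hu.integrable one_le_two).const_mul _)]
        refine integral_congr_ae (hco.mono fun z hz => ?_)
        have := (h.pos z).ne'
        simp only [hz, l.derivFormula_eq]
        field_simp

end ExpandingLift

/-! ### First order transport of densities -/

/-- Mean value inequality for `H - h x * ·`, whose derivative is at most `B * |p - x|` between `x`
and `p`. -/
theorem abs_sub_sub_mul_le {H h : ℝ → ℝ} (hH : ∀ x, HasDerivAt H (h x) x) {B : ℝ} (hB : 0 ≤ B)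
    (hh : ∀ x y, |h x - h y| ≤ B * |x - y|) (p x : ℝ) :
    |H p - H x - h x * (p - x)| ≤ B * |p - x| ^ 2 := by
  have h1 : ∀ y ∈ Set.uIcc x p, HasDerivWithinAt (fun y => H y - h x * y) (h y - h x)
      (Set.uIcc x p) y := fun y _ => by
    have := (hH y).sub ((hasDerivAt_id y).const_mul (h x))
    rw [mul_one] at this
    exact this.hasDerivWithinAt
  have h2 : ∀ y ∈ Set.uIcc x p, ‖h y - h x‖ ≤ B * |p - x| := fun y hy =>
    (hh y x).trans (mul_le_mul_of_nonneg_left (by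
      have := Set.abs_sub_left_of_mem_uIcc hy
      rwa [abs_sub_comm] at this ⊢
      ) hB)
  have h3 := Convex.norm_image_sub_le_of_norm_hasDerivWithin_le h1 h2 (convex_uIcc x p)
    Set.left_mem_uIcc Set.right_mem_uIcc
  simp only [Real.norm_eq_abs] at h3
  calc _ = |H p - h x * p - (H x - h x * x)| := by ring_nf
    _ ≤ _ := h3
    _ = _ := by ring

/-- Integrals of periodic functions are invariant under degree one changes of variables. -/
theorem integral_comp_mul_deriv_of_degree_one {ψ S S' : ℝ → ℝ} (hψ : Continuous ψ)
    (hψp : Function.Periodic ψ 1) (hS : ∀ x, HasDerivAt S (S' x) x) (hS' : Continuous S')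
    (hS1 : S 1 = S 0 + 1) :
    ∫ x in (0 : ℝ)..1, S' x * ψ (S x) = ∫ x in (0 : ℝ)..1, ψ x := by
  have := intervalIntegral.integral_comp_mul_deriv (a := (0 : ℝ)) (b := 1) (f := S)
    (f' := S') (g := ψ) (fun x _ => hS x) hS'.continuousOn hψ
  rw [hS1, hψp.intervalIntegral_add_eq (S 0) 0, zero_add] at this
  rw [← this]
  exact intervalIntegral.integral_congr fun x _ => mul_comm _ _

/-- Applied with `g = ρ v`. If `R` is the distribution function of `ρ` and `Q` its inverse, `X = Q ∘
(R - t g)` carries the perturbed density to `ρ`. From `R x = R p - t g p` a first-order expansion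
gives `p - x ≈ t g x / ρ x`. -/
theorem exists_transport {μ : ProbabilityMeasure S1} {ρ : S1 → ℝ} (h : HasDensity μ ρ)
    (hρ : IsCn 1 ρ) {g : S1 → ℝ} (hg : IsCn 1 g) :
    ∃ C τ : ℝ, 0 < C ∧ 0 < τ ∧ ∀ t, |t| < τ →
      (∀ z, 0 ≤ ρ z - t * grad g z) ∧ ∃ X : S1 → S1, Continuous X ∧
        (dens fun z => ρ z - t * grad g z).map X = (μ : Measure S1) ∧
        ∀ p : ℝ, ∃ x : ℝ, X p = x ∧ |p - x - t * (g x / ρ x)| ≤ C * t ^ 2 := by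
  obtain ⟨m, M, hm, hM, hb⟩ := exists_bounds h.continuous h.pos
  have hr : Continuous fun x : ℝ => ρ x := h.continuous.comp continuous_coe
  have hρd : Differentiable ℝ fun x : ℝ => ρ x := ContDiff.differentiable hρ one_ne_zero
  have hgd : Differentiable ℝ fun x : ℝ => g x := ContDiff.differentiable hg one_ne_zero
  have hgg : Continuous (grad g) := hg.continuous_grad le_rfl
  have hgder : ∀ x : ℝ, HasDerivAt (fun x : ℝ => g x) (grad g x) x := fun x => by
    rw [grad_coe]
    exact (hgd x).hasDerivAt
  obtain ⟨G, hG0, hG⟩ := exists_abs_le_of_periodic (hg.continuous.comp continuous_coe) one_ne_zero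
    (periodic_coe g)
  obtain ⟨G₁, hG₁0, hG₁⟩ := exists_abs_le_of_periodic (hgg.comp continuous_coe) one_ne_zero
    (periodic_coe (grad g))
  obtain ⟨B, hB0, hB⟩ := exists_abs_le_of_periodic
    ((hρ.continuous_grad le_rfl).comp continuous_coe) one_ne_zero (periodic_coe (grad ρ))
  simp only [Function.comp] at hG hG₁ hB
  have hρlip := abs_sub_le_of_abs_deriv_le hρd fun x => by
    rw [← grad_coe]
    exact hB x
  have hglip := abs_sub_le_of_abs_deriv_le hgd fun x => by
    rw [← grad_coe]
    exact hG₁ x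
  set R : ℝ → ℝ := fun x => ∫ u in (0 : ℝ)..x, ρ u with hR
  have hRder : ∀ x : ℝ, HasDerivAt R (ρ x) x := fun x =>
    (hr.integral_hasStrictDerivAt 0 x).hasDerivAt
  have hRd : Differentiable ℝ R := fun x => (hRder x).differentiableAt
  have hRC : ContDiff ℝ 1 R := by
    refine contDiff_one_iff_deriv.2 ⟨hRd, ?_⟩
    rwa [funext fun x => (hRder x).deriv]
  have hmR : ∀ x, m ≤ deriv R x := fun x => by
    rw [(hRder x).deriv]
    exact (hb _).1
  have hI : ∫ x in (0 : ℝ)..1, ρ x = 1 := by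
    have h1 := h.integral_eq fun _ => 1
    simp only [mul_one, integral_const, probReal_univ, smul_eq_mul] at h1
    rw [← integral_eq_intervalIntegral, ← h1]
  have hR1 : ∀ x, R (x + 1) = R x + 1 := fun x => by
    have h1 : (∫ u in (0 : ℝ)..(x + 1), ρ u) - ∫ u in (0 : ℝ)..x, ρ u = 1 := by
      rw [intervalIntegral.integral_interval_sub_left (hr.intervalIntegrable _ _)
        (hr.intervalIntegrable _ _), (periodic_coe ρ).intervalIntegral_add_eq x 0, zero_add, hI]
    simp only [hR]
    linarith
  obtain ⟨Q, hQ, hQR, hRQ⟩ := exists_contDiff_inverse one_ne_zero hRC hm hmR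
  have hQ1 : ∀ y, Q (y + 1) = Q y + 1 := fun y => by
    rw [← hQR (Q y + 1), hR1, hRQ]
  have hg1 : ∀ y : ℝ, g ((y + 1 : ℝ) : S1) = g y := periodic_coe g
  refine ⟨(G₁ * (G / m) + B * (G / m) ^ 2) / m, m / G₁, by positivity, by positivity,
    fun t ht => ?_⟩
  have hpos : ∀ z, 0 ≤ ρ z - t * grad g z := fun z => by
    obtain ⟨x, rfl⟩ := QuotientAddGroup.mk_surjective z
    have h1 : |t * grad g x| ≤ m := by
      rw [abs_mul]
      rw [lt_div_iff₀ hG₁0] at ht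
      exact (mul_le_mul_of_nonneg_left (hG₁ x) (abs_nonneg t)).trans ht.le
    have h2 := (hb x).1
    have h3 := le_abs_self (t * grad g x)
    change 0 ≤ ρ (x : S1) - t * grad g (x : S1)
    linarith
  have hper : Function.Periodic (fun y : ℝ => ((Q (R y - t * g y) : ℝ) : S1)) 1 := fun y => by
    simp only [hR1, hg1]
    rw [show R y + 1 - t * g y = R y - t * g y + 1 by ring, hQ1]
    simp
  refine ⟨hpos, hper.lift, ?_, ?_, fun p => ⟨Q (R p - t * g p), rfl, ?_⟩⟩
  · refine continuous_of_continuous_coe ?_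
    exact continuous_coe.comp (hQ.continuous.comp
      (hRC.continuous.sub (continuous_const.mul (hg.continuous.comp continuous_coe))))
  · have hXc : Continuous (hper.lift : S1 → S1) := by
      refine continuous_of_continuous_coe ?_
      exact continuous_coe.comp (hQ.continuous.comp
        (hRC.continuous.sub (continuous_const.mul (hg.continuous.comp continuous_coe))))
    rw [h.eq_dens]
    refine map_dens_eq hXc (h.continuous.sub (continuous_const.mul hgg)) hpos h.continuous
      (fun x => (h.pos x).le) fun φ hφ => ?_
    rw [integral_eq_intervalIntegral, integral_eq_intervalIntegral]
    have hψ : Continuous fun y : ℝ => φ (Q y : ℝ) :=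
      hφ.comp (continuous_coe.comp hQ.continuous)
    have hψp : Function.Periodic (fun y : ℝ => φ (Q y : ℝ)) 1 := fun y => by
      simp only [hQ1]
      exact periodic_coe φ _
    -- Both integrals reduce to that of `φ ∘ Q` over a period, one through `R - t g`, the other
    -- through `R`. Only nonnegativity of the density is used, not invertibility of `R - t g`.
    have e1 := integral_comp_mul_deriv_of_degree_one hψ hψp
      (S := fun y => R y - t * g y) (S' := fun y => ρ y - t * grad g y)
      (fun x => (hRder x).sub ((hgder x).const_mul t))
      (hr.sub (continuous_const.mul (hgg.comp continuous_coe))) (by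
        have h1 := hR1 0
        have h2 := hg1 0
        rw [zero_add] at h1 h2
        rw [h1, h2]
        ring)
    have e2 := integral_comp_mul_deriv_of_degree_one hψ hψp (S := R) (S' := fun y => ρ y) hRder hr
      (by
        have h1 := hR1 0
        rwa [zero_add] at h1)
    simp only [hQR] at e2
    rw [e2]
    exact e1
  · set x := Q (R p - t * g p) with hx
    have hRx : R x = R p - t * g p := hRQ _
    have h1 : |p - x| ≤ |t| * (G / m) := by
      have h2 := mul_abs_sub_le_of_le_deriv hRd hmR p x
      rw [hRx, show R p - (R p - t * g p) = t * g p by ring, abs_mul] at h2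
      have h3 := mul_le_mul_of_nonneg_left (hG p) (abs_nonneg t)
      rw [← mul_div_assoc, le_div_iff₀ hm, mul_comm]
      exact h2.trans h3
    have h2 := abs_sub_sub_mul_le hRder hB0.le hρlip p x
    have h3 := hglip p x
    have hρx := h.pos (x : S1)
    have h4 : ρ x * |p - x - t * (g x / ρ x)| ≤ t ^ 2 * (G₁ * (G / m) + B * (G / m) ^ 2) := by
      rw [← abs_of_pos hρx, ← abs_mul, abs_of_pos hρx]
      rw [show ρ x * (p - x - t * (g x / ρ x)) =
        t * (g p - g x) - (R p - R x - ρ x * (p - x)) by rw [hRx]; field_simp; ring]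
      refine (abs_sub _ _).trans ?_
      rw [abs_mul]
      calc _ ≤ |t| * (G₁ * (|t| * (G / m))) + B * (|t| * (G / m)) ^ 2 := by
            refine add_le_add (mul_le_mul_of_nonneg_left (h3.trans ?_) (abs_nonneg t))
              (h2.trans ?_)
            · gcongr
            · gcongr
        _ = |t| ^ 2 * (G₁ * (G / m) + B * (G / m) ^ 2) := by ring
        _ = _ := by rw [sq_abs]
    rw [div_mul_eq_mul_div, le_div_iff₀ hm]
    calc _ = m * |p - x - t * (g x / ρ x)| := mul_comm _ _
      _ ≤ ρ x * |p - x - t * (g x / ρ x)| :=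
        mul_le_mul_of_nonneg_right (hb _).1 (abs_nonneg _)
      _ ≤ _ := h4
      _ = _ := by ring

/-! ### Bounds on the Wasserstein distance -/

/-- Two maps on a common source induce a transport plan, so any such pair bounds the distance. -/
theorem W_le {η : Measure S1} {a b : S1 → S1} (ha : Measurable a) (hb : Measurable b)
    {μ₁ μ₂ : ProbabilityMeasure S1} (h₁ : η.map a = (μ₁ : Measure S1))
    (h₂ : η.map b = (μ₂ : Measure S1)) {c : ℝ} (hc : 0 ≤ c)
    (h : ∫⁻ p, edist (a p) (b p) ^ 2 ∂η ≤ ENNReal.ofReal (c ^ 2)) : W μ₁ μ₂ ≤ c := by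
  have hab : Measurable fun p => (a p, b p) := ha.prodMk hb
  have hmem : η.map (fun p => (a p, b p)) ∈ transportPlans μ₁ μ₂ := by
    constructor
    · rw [Measure.map_map measurable_fst hab, ← h₁]
      rfl
    · rw [Measure.map_map measurable_snd hab, ← h₂]
      rfl
  have h3 : (⨅ π ∈ transportPlans μ₁ μ₂, ∫⁻ p, edist p.1 p.2 ^ 2 ∂π) ≤ ENNReal.ofReal (c ^ 2) := by
    refine (iInf₂_le _ hmem).trans ?_
    rwa [lintegral_map (measurable_edist.pow_const 2) hab]
  rw [W, Real.sqrt_le_left hc]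
  exact (ENNReal.toReal_mono ENNReal.ofReal_ne_top h3).trans
    (ENNReal.toReal_ofReal (sq_nonneg c)).le

theorem W_nonneg (μ₁ μ₂ : ProbabilityMeasure S1) : 0 ≤ W μ₁ μ₂ := Real.sqrt_nonneg _

theorem norm_sq_eq_integral {μ : ProbabilityMeasure S1} (u : Lp ℝ 2 (μ : Measure S1)) :
    ∫ x, u x ^ 2 ∂(μ : Measure S1) = ‖u‖ ^ 2 := by
  rw [← real_inner_self_eq_norm_sq, L2.inner_def]
  simp [sq]

theorem grad_eq_of_hasDerivAt {f : S1 → ℝ} {f' x : ℝ} (h : HasDerivAt (fun y : ℝ => f y) f' x) :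
    grad f x = f' := (grad_coe f x).trans h.deriv

theorem mem_span_grad {μ : ProbabilityMeasure S1} {v : Lp ℝ 2 (μ : Measure S1)}
    (hv : v ∈ Submodule.span ℝ {v : Lp ℝ 2 (μ : Measure S1) |
      ∃ f : S1 → ℝ, IsCn ((⊤ : ℕ∞) : WithTop ℕ∞) f ∧ v =ᵐ[(μ : Measure S1)] grad f}) :
    ∃ f : S1 → ℝ, IsCn ((⊤ : ℕ∞) : WithTop ℕ∞) f ∧ v =ᵐ[(μ : Measure S1)] grad f := by
  have hd : ∀ {f : S1 → ℝ}, IsCn ((⊤ : ℕ∞) : WithTop ℕ∞) f → ∀ x : ℝ,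
      HasDerivAt (fun y : ℝ => f y) (grad f x) x := fun {f} hf x => by
    rw [grad_coe]
    exact ((ContDiff.differentiable hf (by simp)) x).hasDerivAt
  induction hv using Submodule.span_induction with
  | mem v hv => exact hv
  | zero =>
    refine ⟨fun _ => 0, contDiff_const, (Lp.coeFn_zero _ _ _).trans (ae_of_all _ fun z => ?_)⟩
    simp [grad]
  | add v w _ _ hv hw =>
    obtain ⟨f, hf, hvf⟩ := hv
    obtain ⟨g, hg, hwg⟩ := hw
    refine ⟨fun z => f z + g z, ContDiff.add hf hg, ?_⟩
    filter_upwards [Lp.coeFn_add v w, hvf, hwg] with z h1 h2 h3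
    rw [h1, Pi.add_apply, h2, h3]
    obtain ⟨x, rfl⟩ := QuotientAddGroup.mk_surjective z
    exact (grad_eq_of_hasDerivAt (f := fun z => f z + g z) ((hd hf x).add (hd hg x))).symm
  | smul a v _ hv =>
    obtain ⟨f, hf, hvf⟩ := hv
    refine ⟨fun z => a * f z, contDiff_const.mul hf, ?_⟩
    filter_upwards [Lp.coeFn_smul a v, hvf] with z h1 h2
    rw [h1, Pi.smul_apply, h2]
    obtain ⟨x, rfl⟩ := QuotientAddGroup.mk_surjective z
    exact (grad_eq_of_hasDerivAt (f := fun z => a * f z) ((hd hf x).const_mul a)).symm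

/-! ### Gâteaux differentiability -/

namespace ExpandingLift

variable {Φ : S1 → S1} (l : ExpandingLift Φ) {μ : ProbabilityMeasure S1} {ρ : S1 → ℝ}

theorem isCn_fiberSum (l : ExpandingLift Φ) {k : S1 → ℝ} (hk : IsCn 1 k) :
    IsCn 1 (fiberSum Φ k) := by
  have hE : ContDiff ℝ 1 l.E := l.contDiff_E.of_le one_le_two
  have hk' : ContDiff ℝ 1 fun x : ℝ => k x := hk
  simp only [IsCn, l.fiberSum_coe, branch]
  refine ContDiff.sum fun j _ => ?_
  exact hk'.comp (hE.comp (contDiff_id.add contDiff_const))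

/-- The chain rule through `E` contributes `s * w = s / |Φ'|` on each branch. -/
theorem grad_fiberSum {k : S1 → ℝ} (hk : IsCn 1 k) (z : S1) :
    grad (fiberSum Φ k) z = fiberSum Φ (fun y => l.s * grad k y / |circleDeriv Φ y|) z := by
  obtain ⟨x, rfl⟩ := QuotientAddGroup.mk_surjective z
  refine (grad_eq_of_hasDerivAt ?_).trans (l.fiberSum_coe _ x).symm
  simp only [l.fiberSum_coe, branch]
  refine HasDerivAt.fun_sum fun j _ => ?_
  have h1 : HasDerivAt (fun x => l.E (x + j)) (l.s * l.w (x + j)) x := by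
    have := (l.differentiable_E (x + j)).hasDerivAt.comp_add_const x j
    rwa [deriv_E_eq] at this
  have h2 : HasDerivAt (fun y : ℝ => k y) (grad k (l.E (x + j) : ℝ)) (l.E (x + j)) := by
    rw [grad_coe]
    exact (ContDiff.differentiable hk one_ne_zero _).hasDerivAt
  have h3 := h2.comp x h1
  rw [l.circleDeriv_coe, l.abs_deriv, div_eq_mul_inv, ← l.w_eq]
  exact h3.congr_deriv (by ring)

/-- After multiplication by `ρ` the correction term is a constant, hence invisible to the gradient.
-/
theorem mul_derivFormula (h : HasDensity μ ρ) (v : S1 → ℝ) (x : S1) :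
    ρ x * derivFormula Φ ρ v x = fiberSum Φ (fun y => l.s * (ρ y * v y)) x -
      (∫ y : S1, v y * circleDeriv Φ y * (ρ y / ρ (Φ y))) / (∫ y : S1, 1 / ρ y) := by
  have := (h.pos x).ne'
  rw [l.derivFormula_eq]
  simp only [← mul_assoc]
  field_simp

theorem isCn_const_mul {k : S1 → ℝ} (c : ℝ) (hk : IsCn 1 k) : IsCn 1 fun y => c * k y :=
  contDiff_const.mul hk

theorem grad_const_mul {k : S1 → ℝ} (c : ℝ) (hk : IsCn 1 k) (z : S1) :
    grad (fun y => c * k y) z = c * grad k z := by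
  obtain ⟨x, rfl⟩ := QuotientAddGroup.mk_surjective z
  refine grad_eq_of_hasDerivAt (HasDerivAt.const_mul c ?_)
  exact (grad_coe k x) ▸ (ContDiff.differentiable hk one_ne_zero x).hasDerivAt

theorem isCn_mul_derivFormula (l : ExpandingLift Φ) (h : HasDensity μ ρ) {v : S1 → ℝ}
    (hg : IsCn 1 fun y => ρ y * v y) : IsCn 1 fun x => ρ x * derivFormula Φ ρ v x := by
  rw [funext (l.mul_derivFormula h v)]
  exact ContDiff.sub (l.isCn_fiberSum (isCn_const_mul l.s hg)) contDiff_const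

theorem grad_mul_derivFormula (l : ExpandingLift Φ) (h : HasDensity μ ρ) {v : S1 → ℝ}
    (hg : IsCn 1 fun y => ρ y * v y) (z : S1) :
    grad (fun x => ρ x * derivFormula Φ ρ v x) z =
      fiberSum Φ (fun y => grad (fun y => ρ y * v y) y / |circleDeriv Φ y|) z := by
  rw [funext (l.mul_derivFormula h v)]
  have h1 := l.grad_fiberSum (isCn_const_mul l.s hg) z
  have h2 : ∀ y, l.s * grad (fun y => l.s * (ρ y * v y)) y / |circleDeriv Φ y| =
      grad (fun y => ρ y * v y) y / |circleDeriv Φ y| := fun y => by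
    rw [grad_const_mul l.s hg, ← mul_assoc, l.s_mul_s, one_mul]
  simp only [h2] at h1
  rw [← h1]
  simp only [grad, deriv_sub_const_fun]

/-- Push-forward acts linearly on densities, fixes `ρ` by `hfix`, and sends `(ρ v)'` to the
derivative of `ρ` times the formula, the two signs `s` cancelling. -/
theorem map_dens_sub (l : ExpandingLift Φ) (h : HasDensity μ ρ)
    (hfix : (fiberSum Φ fun y => ρ y / |circleDeriv Φ y|) = ρ) {v : S1 → ℝ}
    (hg : IsCn 1 fun y => ρ y * v y) {t : ℝ}
    (h0 : ∀ z, 0 ≤ ρ z - t * grad (fun y => ρ y * v y) z) :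
    (dens fun z => ρ z - t * grad (fun y => ρ y * v y) z).map Φ =
      dens fun z => ρ z - t * grad (fun x => ρ x * derivFormula Φ ρ v x) z := by
  rw [map_dens (h := fun z => ρ z - t * grad (fun y => ρ y * v y) z) (h.continuous.sub (continuous_const.mul (hg.continuous_grad le_rfl))) h0 l]
  congr 1
  ext z
  rw [l.grad_mul_derivFormula h hg]
  rw [← congrFun hfix z]
  simp only [l.fiberSum_eq, Finset.mul_sum, ← Finset.sum_sub_distrib]
  exact Finset.sum_congr rfl fun j _ => by ring

theorem edist_sq_le_ofReal {a b : S1} {c : ℝ} (h : dist a b ≤ c) {d : ℝ} (hd : c ^ 2 ≤ d) :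
    edist a b ^ 2 ≤ ENNReal.ofReal d := by
  rw [edist_dist, ← ENNReal.ofReal_pow dist_nonneg]
  exact ENNReal.ofReal_le_ofReal ((pow_le_pow_left₀ dist_nonneg h 2).trans hd)

theorem dist_coe_le (x y : ℝ) : dist (x : S1) (y : S1) ≤ |x - y| := by
  rw [dist_eq_norm, ← AddCircle.coe_sub]
  exact norm_coe_le_abs _

theorem abs_F_sub_le (x y : ℝ) : |l.F x - l.F y| ≤ l.K * |x - y| :=
  abs_sub_le_of_abs_deriv_le l.differentiable_F l.abs_deriv_le x y

theorem sq_add_add_le (a b c : ℝ) : (a + b + c) ^ 2 ≤ 3 * (a ^ 2 + b ^ 2 + c ^ 2) := by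
  nlinarith [sq_nonneg (a - b), sq_nonneg (b - c), sq_nonneg (a - c)]

theorem edist_sq_le {C₁ C₂ t p x z a b d₁ d₂ : ℝ} (hx : |p - x - t * a| ≤ C₁ * t ^ 2)
    (hz : |l.F p - z - t * b| ≤ C₂ * t ^ 2) :
    edist (Φ ((x + t * (a + d₁) : ℝ) : S1)) ((z + t * (b + d₂) : ℝ) : S1) ^ 2 ≤ ENNReal.ofReal
      (3 * t ^ 2 * (l.K ^ 2 * d₁ ^ 2 + (l.K * C₁ + C₂) ^ 2 * t ^ 2 + d₂ ^ 2)) := by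
  rw [l.map_coe]
  have hK := l.K_pos
  -- Both points are compared with `Φ p`, lifted to `F p`. The three terms are the error `d₁`
  -- magnified by `F`, the two transport errors, and the error `d₂`.
  refine edist_sq_le_ofReal (c := |t| * (l.K * |d₁|) + (l.K * C₁ + C₂) * t ^ 2 + |t| * |d₂|)
    ((dist_coe_le _ _).trans ?_) ?_
  · have e1 := l.abs_F_sub_le (x + t * (a + d₁)) p
    have e2 : |x + t * (a + d₁) - p| ≤ |t| * |d₁| + C₁ * t ^ 2 := by
      rw [show x + t * (a + d₁) - p = t * d₁ - (p - x - t * a) by ring]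
      refine (abs_sub _ _).trans ?_
      rw [abs_mul]
      exact add_le_add le_rfl hx
    have e3 : |l.F p - (z + t * (b + d₂))| ≤ C₂ * t ^ 2 + |t| * |d₂| := by
      rw [show l.F p - (z + t * (b + d₂)) = (l.F p - z - t * b) - t * d₂ by ring]
      refine (abs_sub _ _).trans ?_
      rw [abs_mul]
      exact add_le_add hz le_rfl
    have e4 := abs_sub_le (l.F (x + t * (a + d₁))) (l.F p) (z + t * (b + d₂))
    have e5 := mul_le_mul_of_nonneg_left e2 hK.le
    linarith
  · refine (sq_add_add_le _ _ _).trans_eq ?_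
    rw [mul_pow, mul_pow, mul_pow, mul_pow, sq_abs, sq_abs, sq_abs]
    ring

theorem measurable_exp {μ : ProbabilityMeasure S1} (v : Lp ℝ 2 (μ : Measure S1)) :
    Measurable fun x : S1 => x + ((v x : ℝ) : S1) :=
  measurable_id.add (continuous_coe.measurable.comp (Lp.stronglyMeasurable v).measurable)

theorem integral_comp_of_measurePreserving {η ν : Measure S1} {X : S1 → S1}
    (hX : MeasurePreserving X η ν) {k : S1 → ℝ} (hk : Integrable k ν) :
    Integrable (fun p => k (X p)) η ∧ ∫ p, k (X p) ∂η = ∫ x, k x ∂ν := by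
  obtain ⟨hXm, rfl⟩ := hX
  exact ⟨hk.comp_measurable hXm, (integral_map hXm.aemeasurable hk.aestronglyMeasurable).symm⟩

theorem integral_sq_comp {η : Measure S1} {X : S1 → S1}
    (hX : MeasurePreserving X η (μ : Measure S1)) (D : Lp ℝ 2 (μ : Measure S1)) :
    Integrable (fun p => D (X p) ^ 2) η ∧ ∫ p, D (X p) ^ 2 ∂η = ‖D‖ ^ 2 := by
  rw [← norm_sq_eq_integral]
  exact integral_comp_of_measurePreserving hX (k := fun x => D x ^ 2) (Lp.memLp D).integrable_sq

theorem map_comp_of_measurePreserving {η ν : Measure S1} {X a : S1 → S1}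
    (hX : MeasurePreserving X η ν) (ha : Measurable a) :
    η.map (fun p => a (X p)) = ν.map a := by
  rw [← hX.map_eq, Measure.map_map ha hX.measurable]
  rfl

/-- First order estimate along a field `v` close to the gradient of a smooth function. -/
theorem W_push_le (l : ExpandingLift Φ) (hΦ : Measurable Φ) (h : HasDensity μ ρ) (hρ : IsCn 1 ρ)
    (hfix : (fiberSum Φ fun y => ρ y / |circleDeriv Φ y|) = ρ) {f : S1 → ℝ}
    (hf : IsCn ((⊤ : ℕ∞) : WithTop ℕ∞) f) :
    ∃ C τ : ℝ, 0 < τ ∧ ∀ t, |t| < τ → ∀ v w D D₂ : Lp ℝ 2 (μ : Measure S1),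
      (∀ᵐ x ∂(μ : Measure S1), v x = t * (grad f x + D x)) →
      (∀ᵐ x ∂(μ : Measure S1), w x = t * (derivFormula Φ ρ (grad f) x + D₂ x)) →
      W (push Φ hΦ (expMap μ v)) (expMap μ w) ≤
        |t| * √(3 * (l.K ^ 2 * ‖D‖ ^ 2 + C * t ^ 2 + ‖D₂‖ ^ 2)) := by
  have hg : IsCn 1 fun y => ρ y * grad f y := by
    have h1 : ContDiff ℝ 2 fun x : ℝ => f x := by
      exact_mod_cast contDiff_infty.1 hf 2
    have h2 : ContDiff ℝ 1 (deriv fun x : ℝ => f x) := h1.iterate_deriv' 1 1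
    simp only [IsCn, grad_coe]
    exact ContDiff.mul hρ h2
  obtain ⟨C₁, τ₁, hC₁, hτ₁, H₁⟩ := exists_transport h hρ hg
  obtain ⟨C₂, τ₂, hC₂, hτ₂, H₂⟩ := exists_transport h hρ (l.isCn_mul_derivFormula h hg)
  refine ⟨(l.K * C₁ + C₂) ^ 2, min τ₁ τ₂, lt_min hτ₁ hτ₂, fun t ht v w D D₂ hv hw => ?_⟩
  obtain ⟨h0, X, hX, hXμ, hXp⟩ := H₁ t (ht.trans_le (min_le_left _ _))
  obtain ⟨-, Y, hY, hYμ, hYp⟩ := H₂ t (ht.trans_le (min_le_right _ _))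
  set η := dens fun z => ρ z - t * grad (fun y => ρ y * grad f y) z with hη
  have hmX : MeasurePreserving X η μ := ⟨hX.measurable, hXμ⟩
  -- `Y` is built for the density of `Φ_# η`, so `X` and `Y ∘ Φ` both carry `η` to `μ`; this common
  -- source supplies the coupling.
  have hmZ : MeasurePreserving (fun p => Y (Φ p)) η μ := by
    refine ⟨hY.measurable.comp hΦ, ?_⟩
    rw [← hYμ, ← l.map_dens_sub h hfix hg h0, Measure.map_map hY.measurable hΦ]
    rfl
  have hηu : η Set.univ = 1 := by
    have := hmX.measure_preimage MeasurableSet.univ.nullMeasurableSet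
    simpa using this
  have hηp : IsProbabilityMeasure η := ⟨hηu⟩
  have hmv := measurable_exp v
  have hmw := measurable_exp w
  obtain ⟨hi1, hI1⟩ := integral_sq_comp hmX D
  obtain ⟨hi2, hI2⟩ := integral_sq_comp hmZ D₂
  refine W_le (η := η) (a := fun p => Φ (X p + ((v (X p) : ℝ) : S1)))
    (b := fun p => Y (Φ p) + ((w (Y (Φ p)) : ℝ) : S1))
    (hΦ.comp (hmv.comp hmX.measurable)) (hmw.comp hmZ.measurable) ?_ ?_ (by positivity) ?_
  · refine (map_comp_of_measurePreserving hmX (hΦ.comp hmv)).trans ?_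
    exact (Measure.map_map hΦ hmv).symm
  · exact map_comp_of_measurePreserving hmZ hmw
  · set Θ : S1 → ℝ := fun p => 3 * t ^ 2 * (l.K ^ 2 * D (X p) ^ 2 +
      (l.K * C₁ + C₂) ^ 2 * t ^ 2 + D₂ (Y (Φ p)) ^ 2) with hΘ
    have hΘi : Integrable Θ η :=
      (((hi1.const_mul _).add (integrable_const _)).add hi2).const_mul _
    have hΘ0 : ∀ p, 0 ≤ Θ p := fun p => by positivity
    have hΘI : ∫ p, Θ p ∂η = (|t| * √(3 * (l.K ^ 2 * ‖D‖ ^ 2 +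
        (l.K * C₁ + C₂) ^ 2 * t ^ 2 + ‖D₂‖ ^ 2))) ^ 2 := by
      have j1 : Integrable (fun p => l.K ^ 2 * D (X p) ^ 2) η := hi1.const_mul _
      have j2 : Integrable (fun p => l.K ^ 2 * D (X p) ^ 2 +
          (l.K * C₁ + C₂) ^ 2 * t ^ 2) η := j1.add (integrable_const _)
      rw [mul_pow, Real.sq_sqrt (by positivity), sq_abs, hΘ, integral_const_mul,
        integral_add j2 hi2, integral_add j1 (integrable_const _), integral_const_mul, hI1, hI2]
      simp
      ring
    rw [← hΘI, ofReal_integral_eq_lintegral_ofReal hΘi (ae_of_all _ hΘ0)]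
    refine lintegral_mono_ae ?_
    filter_upwards [hmX.quasiMeasurePreserving.ae hv, hmZ.quasiMeasurePreserving.ae hw]
      with q hq1 hq2
    obtain ⟨p, hp⟩ : ∃ p : ℝ, (p : S1) = q := ⟨_, coe_toIoc q⟩
    obtain ⟨x, hx, hxe⟩ := hXp p
    obtain ⟨z, hz, hze⟩ := hYp (l.F p)
    rw [← l.map_coe, hp] at hz
    rw [hp] at hx
    rw [mul_div_cancel_left₀ _ (h.pos (x : S1)).ne'] at hxe
    rw [mul_div_cancel_left₀ _ (h.pos (z : S1)).ne'] at hze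
    simp only [hΘ]
    rw [hq1, hq2, hx, hz, ← AddCircle.coe_add, ← AddCircle.coe_add]
    exact l.edist_sq_le hxe hze

/-- The branch pushes `volume` to a measure dominated by `dens |Φ'|`, so it pulls null sets back to
null sets. -/
theorem ae_comp_branch {p : S1 → Prop} (hp : ∀ᵐ z : S1, p z) {j : ℕ}
    (hj : j ∈ Finset.range l.N) : ∀ᵐ z : S1, p (l.branch j (toIoc z)) := by
  refine ae_of_ae_map (l.measurable_branch_toIoc j).aemeasurable ?_
  have h1 : (volume : Measure S1).map (fun z => l.branch j (toIoc z)) ≤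
      dens fun z => |circleDeriv Φ z| := by
    rw [← l.sum_map_branch_toIoc]
    exact Finset.single_le_sum
      (f := fun j => (volume : Measure S1).map (fun z => l.branch j (toIoc z)))
      (fun _ _ => Measure.zero_le _) hj
  exact ((Measure.absolutelyContinuous_of_le h1).trans (dens_absolutelyContinuous _)).ae_le hp

theorem fiberSum_congr_ae (l : ExpandingLift Φ) {k k' : S1 → ℝ} (h : k =ᵐ[volume] k') :
    fiberSum Φ k =ᵐ[volume] fiberSum Φ k' := by
  have h1 : ∀ᵐ z : S1, ∀ j ∈ Finset.range l.N,
      k (l.branch j (toIoc z)) = k' (l.branch j (toIoc z)) := by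
    rw [Filter.eventually_all_finset]
    exact fun j hj => l.ae_comp_branch h hj
  filter_upwards [h1] with z hz
  rw [l.fiberSum_eq, l.fiberSum_eq]
  exact Finset.sum_congr rfl hz

theorem derivFormula_congr_ae (l : ExpandingLift Φ) {v v' : S1 → ℝ} (h : v =ᵐ[volume] v') :
    derivFormula Φ ρ v =ᵐ[volume] derivFormula Φ ρ v' := by
  have h1 : (fun y => l.s * ρ y * v y) =ᵐ[volume] fun y => l.s * ρ y * v' y :=
    h.mono fun y hy => by simp only [hy]
  have h2 : ∫ y : S1, v y * circleDeriv Φ y * (ρ y / ρ (Φ y)) =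
      ∫ y : S1, v' y * circleDeriv Φ y * (ρ y / ρ (Φ y)) :=
    integral_congr_ae (h.mono fun y hy => by simp only [hy])
  filter_upwards [l.fiberSum_congr_ae h1] with x hx
  rw [l.derivFormula_eq, l.derivFormula_eq, hx, h2]

theorem isLittleO_W (hΦ : Measurable Φ) (h : HasDensity μ ρ) (hρ : IsCn 1 ρ)
    (hmp : MeasurePreserving Φ (μ : Measure S1) μ)
    (hfix : (fiberSum Φ fun y => ρ y / |circleDeriv Φ y|) = ρ) (v : L20 μ) :
    (fun t : ℝ => W (push Φ hΦ (expMap μ (t • (v : Lp ℝ 2 (μ : Measure S1)))))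
      (expMap μ (t • (l.derivL20 h hmp v : Lp ℝ 2 (μ : Measure S1))))) =o[𝓝 0]
        (fun t : ℝ => t) := by
  set L := l.derivL20 h hmp with hL
  rw [isLittleO_iff]
  intro c hc
  set A := 3 * (l.K ^ 2 + ‖L‖ ^ 2) + 1 with hA
  have hA0 : 0 < A := by positivity
  -- With this accuracy the approximation error uses half of `c ^ 2`; the other half is left for the
  -- term in `t ^ 2`.
  set ε := min 1 (c ^ 2 / (2 * A)) with hε
  have hε0 : 0 < ε := by positivity
  have hεA : 3 * (l.K ^ 2 + ‖L‖ ^ 2) * ε ^ 2 ≤ c ^ 2 / 2 := by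
    have h1 : ε ≤ 1 := min_le_left _ _
    have h2 : ε ≤ c ^ 2 / (2 * A) := min_le_right _ _
    calc 3 * (l.K ^ 2 + ‖L‖ ^ 2) * ε ^ 2 ≤ A * ε := by
          have h3 : ε ^ 2 ≤ ε := by nlinarith
          refine mul_le_mul (by linarith) h3 (by positivity) hA0.le
      _ ≤ A * (c ^ 2 / (2 * A)) := by gcongr
      _ = c ^ 2 / 2 := by field_simp
  obtain ⟨V, hV, hvV⟩ := Metric.mem_closure_iff.1 v.2 ε hε0
  obtain ⟨f, hf, hVf⟩ := mem_span_grad hV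
  have hVmem : V ∈ L20 μ := Submodule.le_topologicalClosure _ hV
  set V' : L20 μ := ⟨V, hVmem⟩ with hV'
  obtain ⟨C, τ, hτ, H⟩ := l.W_push_le hΦ h hρ hfix hf
  have hD : ‖(v : Lp ℝ 2 (μ : Measure S1)) - V‖ ≤ ε := by
    rw [← dist_eq_norm]
    exact hvV.le
  -- Continuity of the derivative operator carries the approximation error of `v` over to its image.
  have hD₂ : ‖(L v : Lp ℝ 2 (μ : Measure S1)) - (L V' : Lp ℝ 2 (μ : Measure S1))‖ ≤ ‖L‖ * ε := by
    have h1 : ‖L (v - V')‖ ≤ ‖L‖ * ‖v - V'‖ := L.le_opNorm _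
    rw [map_sub] at h1
    exact h1.trans (mul_le_mul_of_nonneg_left hD L.opNorm_nonneg)
  have hlim : Tendsto (fun t : ℝ => 3 * (C * t ^ 2)) (𝓝 0) (𝓝 0) := by
    have : Continuous fun t : ℝ => 3 * (C * t ^ 2) := by fun_prop
    simpa using this.tendsto 0
  have hτ' : ∀ᶠ t : ℝ in 𝓝 0, |t| < τ := by
    have : Tendsto (fun t : ℝ => |t|) (𝓝 0) (𝓝 0) := by
      simpa using (continuous_abs (G := ℝ)).tendsto 0
    exact this.eventually (gt_mem_nhds hτ)
  filter_upwards [hlim.eventually (gt_mem_nhds (show 0 < c ^ 2 / 2 by positivity)), hτ']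
    with t ht1 ht2
  rw [Real.norm_of_nonneg (W_nonneg _ _), Real.norm_eq_abs, mul_comm]
  refine (H t ht2 _ _ ((v : Lp ℝ 2 (μ : Measure S1)) - V)
    ((L v : Lp ℝ 2 (μ : Measure S1)) - (L V' : Lp ℝ 2 (μ : Measure S1))) ?_ ?_).trans ?_
  · filter_upwards [Lp.coeFn_smul t (v : Lp ℝ 2 (μ : Measure S1)),
      Lp.coeFn_sub (v : Lp ℝ 2 (μ : Measure S1)) V, hVf] with x h1 h2 h3
    rw [h1, h2, Pi.smul_apply, Pi.sub_apply, h3, smul_eq_mul]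
    ring
  · have h0 : derivFormula Φ ρ V =ᵐ[(μ : Measure S1)] derivFormula Φ ρ (grad f) := by
      rw [Filter.EventuallyEq, h.ae_eq] at hVf ⊢
      exact l.derivFormula_congr_ae hVf
    filter_upwards [Lp.coeFn_smul t (L v : Lp ℝ 2 (μ : Measure S1)),
      Lp.coeFn_sub (L v : Lp ℝ 2 (μ : Measure S1)) (L V' : Lp ℝ 2 (μ : Measure S1)),
      l.coeFn_derivL20 h hmp V', h0] with x h1 h2 h3 h4
    rw [h1, h2, Pi.smul_apply, Pi.sub_apply, ← hL] at *
    rw [h3, ← h4, smul_eq_mul]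
    ring
  · refine mul_le_mul_of_nonneg_left (Real.sqrt_le_iff.2 ⟨hc.le, ?_⟩) (abs_nonneg t)
    have h1 := pow_le_pow_left₀ (norm_nonneg _) hD 2
    have h2 := pow_le_pow_left₀ (norm_nonneg _) hD₂ 2
    have h3 := mul_le_mul_of_nonneg_left h1 (sq_nonneg l.K)
    rw [mul_pow] at h2
    linarith

end ExpandingLift

/-! ### Absence of atoms and assembly of the theorem. -/

theorem nullSingletonClass_dens (ρ : S1 → ℝ) : NullSingletonClass (dens ρ) := by
  refine ⟨fun x => dens_absolutelyContinuous ρ ?_⟩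
  have h := AddCircle.volume_closedBall 1 (x := (x : S1)) 0
  rw [Metric.closedBall_zero] at h
  simpa using h

end CircleTransport
end

theorem mainTheorem3 (Φ : S1 → S1) (hΦ : IsC2Expanding Φ) :
    ∃ (μ : ProbabilityMeasure S1) (ρ : S1 → ℝ),
      -- `μ` is the unique absolutely continuous invariant probability measure of `Φ`
      (∀ ν : ProbabilityMeasure S1,
        ((ν : Measure S1) ≪ volume ∧ push Φ hΦ.measurable ν = ν) ↔ ν = μ) ∧
      -- it has a positive `C¹` density `ρ`
      IsCn 1 ρ ∧ (∀ x, 0 < ρ x) ∧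
      (μ : Measure S1) = (volume : Measure S1).withDensity (fun x => ENNReal.ofReal (ρ x)) ∧
      -- `L²_0(μ)` consists of the vector fields of Lebesgue mean zero
      (∀ v : Lp ℝ 2 (μ : Measure S1),
        Integrable v (volume : Measure S1) ∧ (v ∈ L20 μ ↔ ∫ x : S1, v x = 0)) ∧
      -- the derivative and its adjoint
      ∃ L : L20 μ →L[ℝ] L20 μ,
        HasGateauxDerivAt (push Φ hΦ.measurable) L ∧
        (∀ v : L20 μ, ((L v : Lp ℝ 2 (μ : Measure S1)) : S1 → ℝ) =ᵐ[(μ : Measure S1)] fun x =>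
          (∑ᶠ y ∈ Φ ⁻¹' {x}, Real.sign (circleDeriv Φ y) * (ρ y / ρ x) *
              (v : Lp ℝ 2 (μ : Measure S1)) y) -
            (∫ y : S1, (v : Lp ℝ 2 (μ : Measure S1)) y * circleDeriv Φ y * (ρ y / ρ (Φ y))) /
              (ρ x * ∫ y : S1, 1 / ρ y)) ∧
        (∀ u : L20 μ, ((ContinuousLinearMap.adjoint L u : Lp ℝ 2 (μ : Measure S1)) : S1 → ℝ)
          =ᵐ[(μ : Measure S1)] fun x =>
            circleDeriv Φ x * (u : Lp ℝ 2 (μ : Measure S1)) (Φ x)) := by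
  obtain ⟨l⟩ := hΦ.nonempty_lift
  obtain ⟨μ, ρ, hρ, hpos, hμ, hfix, huniq⟩ := l.exists_invariant_measure hΦ.measurable
  have h : HasDensity μ ρ := ⟨hρ.continuous, hpos, hμ⟩
  have hinv : push Φ hΦ.measurable μ = μ := ((huniq μ).2 rfl).2
  have hmp : MeasurePreserving Φ (μ : Measure S1) μ :=
    ⟨hΦ.measurable, congrArg Subtype.val hinv⟩
  refine ⟨μ, ρ, huniq, hρ, hpos, hμ, fun v => ⟨h.integrable_volume v, h.mem_L20_iff v⟩,
    l.derivL20 h hmp, ⟨hinv, ?_, fun v => ?_⟩, fun v => l.coeFn_derivL20 h hmp v,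
    fun u => l.adjoint_derivL20 h hmp u⟩
  · rw [hμ]
    exact nullSingletonClass_dens ρ
  · exact l.isLittleO_W hΦ.measurable h hρ hmp hfix v
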